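/- Let $d\ge 1$ and let $q\colon\mathbb Z^d\to[0,\infty]$ be an even function for which the limit $$s:=-\lim_{|x|\to\infty}\frac{\log q(x)}{\log|x|}$$ ($|x|$ the Euclidean norm) exists and satisfies $s\in(d,2d)$. Put $\Delta:=\dfrac{\log 2}{\log(2d/s)}$. Consider the random graph with vertex set $\mathbb Z^d$ that contains all nearest-neighbour edges of $\mathbb Z^d$ and in which, in addition, every unordered pair of distinct sites $x,y$ is joined by an edge with probability $1-e^{-q(x-y)}$ (with $e^{-\infty}=0$), independently for different pairs. Let $D(x,y)$ be the graph distance, let $B(0,r):=\{x\in\mathbb Z^d\colon D(0,x)\le r\}$, and for real $L$ let $\Lambda_L:=[-L,L]^d\cap\mathbb Z^d$. Then for every $\epsilon>0$, $$\lim_{r\to\infty}\mathbb P\Bigl(\Lambda_{\exp\{r^{1/\Delta-\epsilon}\}}\subset B(0,r)\subset\Lambda_{\exp\{r^{1/\Delta+\epsilon}\}}\Bigr)=1,$$ where $r$ runs through the reals. In particular, almost surely $B(0,r)$ is finite for all $r$, and $$\frac{\log\log|B(0,r)|}{\log r}\longrightarrow\frac1\Delta\quad\text{in probability as } r\to\infty.$$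 -/

import Mathlib

open Filter Topology MeasureTheory ProbabilityTheory
open scoped ENNReal

noncomputable section

namespace LongRange

/-- The sites of the hypercubic lattice `ℤ^d`. -/
abbrev Site (d : ℕ) : Type := Fin d → ℤ

/-- The Euclidean norm `|x|` of a lattice site. -/
def euclNorm {d : ℕ} (x : Site d) : ℝ := Real.sqrt (∑ i, (x i : ℝ) ^ 2)

/-- The filter `|x| → ∞` on `ℤ^d`. -/
def siteAtInfty (d : ℕ) : Filter (Site d) := comap euclNorm atTop

/-- The limit `s = - lim_{|x| → ∞} log q(x) / log |x|` exists. The logarithm of `q(x) ∈ [0, ∞]` and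
the quotient are taken in the extended reals, with `log 0 = -∞` and `log ∞ = ∞`. -/
def HasDecayExponent {d : ℕ} (q : Site d → ℝ≥0∞) (s : ℝ) : Prop :=
  Tendsto (fun x : Site d => ENNReal.log (q x) / ((Real.log (euclNorm x) : ℝ) : EReal))
    (siteAtInfty d) (𝓝 ((-s : ℝ) : EReal))

/-- The probability `1 - e^{-t}` for `t ∈ [0, ∞]`; it equals `1` at `t = ∞`. -/
def edgeProb (t : ℝ≥0∞) : ℝ≥0∞ := 1 - EReal.exp (-(t : EReal))

/-- The random set `E` of added edges, defined on the probability space `(Ω, μ)`: the events that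
the pair `{x, y}` is an edge, over all unordered pairs of distinct sites, are independent, and each
has probability `1 - e^{-q(x - y)}`. -/
structure IsLongRangePercolation {d : ℕ} {Ω : Type*} [MeasurableSpace Ω] (q : Site d → ℝ≥0∞)
    (μ : Measure Ω) (E : Ω → Set (Sym2 (Site d))) : Prop where
  measurableSet_edge : ∀ e : Sym2 (Site d), ¬ e.IsDiag → MeasurableSet {ω | e ∈ E ω}
  indep : iIndepSet (fun e : {e : Sym2 (Site d) // ¬ e.IsDiag} => {ω | (e : Sym2 (Site d)) ∈ E ω}) μ
  prob_edge : ∀ x y : Site d, x ≠ y → μ {ω | s(x, y) ∈ E ω} = edgeProb (q (x - y))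

/-- The nearest-neighbour graph on `ℤ^d`. -/
def latticeGraph (d : ℕ) : SimpleGraph (Site d) where
  Adj x y := ∑ i, |x i - y i| = 1
  symm := ⟨fun x y h => by simpa only [abs_sub_comm] using h⟩
  loopless := ⟨fun x h => by simp at h⟩

/-- The graph on `ℤ^d` with all nearest-neighbour edges and, in addition, the edges in `E`. -/
def percGraph {d : ℕ} (E : Set (Sym2 (Site d))) : SimpleGraph (Site d) :=
  latticeGraph d ⊔ SimpleGraph.fromEdgeSet E

/-- The intrinsic ball `B(0, r)`, i.e. the sites at graph distance at most `r` from the origin. -/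
def intrinsicBall {d : ℕ} (E : Set (Sym2 (Site d))) (r : ℝ) : Set (Site d) :=
  {x | (((percGraph E).edist 0 x : ℝ≥0∞) : EReal) ≤ (r : EReal)}

/-- The box `Λ_L = [-L, L]^d ∩ ℤ^d`, for real `L`. -/
def box (d : ℕ) (L : ℝ) : Set (Site d) := {x | ∀ i, |(x i : ℝ)| ≤ L}

/-- The exponent `Δ = log 2 / log (2d / s)`. -/
def Delta (d : ℕ) (s : ℝ) : ℝ := Real.log 2 / Real.log (2 * d / s)

end LongRange

end

/-! Write $w=1/\Delta=\log_2(2d/s)$; the two inclusions have separate proofs.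

Balls are not too large (`IsLongRangePercolation.tendsto_measure_not_subset_box`). Let $M_n$ bound
the expected volume of a ball of radius $n$. A simple path of at most $n$ steps from $x$ to $y$
contains an edge longer than $|x-y|/(2n)$, and the parts before and after it use other edges. The
van den Berg–Kesten inequality then bounds $P(D(x,y)\le n)$ by $a|x-y|^{-s'}$, where $s'<s$ is close
to $s$ and $a$ is $\sum_k M_kM_{n-1-k}$ up to a power of $n$. Interpolating with the trivial bound 1
and summing over $y$ gives $M_n\lesssim 1+a^t$ for any $t\in(d/s',1]$. If $M_k\le e^{Kk^\theta}$ for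
$k<n$, concavity gives $M_kM_{n-1-k}\le\exp(2^{1-\theta}Kn^\theta)$, so the induction closes once
$t2^{1-\theta}<1$. Such $t$ and $s'$ exist when $2^\theta>2d/s$, that is, $\theta>w$. A union bound
over far sites finishes.

Balls are not too small (`IsLongRangePercolation.tendsto_measure_not_box_subset`). In a dyadic box
of side $2^m$, the sub-boxes of side $2^{\lceil\gamma m\rceil}$ around $x$ and $y$ are joined by an
edge except with probability about $\exp(-c2^{m(2d\gamma-s)})$, which is tiny if $2d\gamma>s$. Edges
inside the two sub-boxes and edges between them are independent, so the exponential moment $e^{b_m}$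
of the distance inside the box satisfies $b_m\le 2b_{\lceil\gamma m\rceil}+2l$. Hence $b_m\lesssim
m^\kappa$ with $\gamma^\kappa$ slightly below $1/2$; $\kappa=1/\nu$ is available for every $\nu<w$.
With $l$ of order $r^{\theta-1}$, $m$ of order $r^\theta$ and $\theta<\nu$, this yields $b_m\le
r^\theta$, and Markov's inequality beats the $e^{O(r^\theta)}$ sites of the box. Truncating the
distance just above $r$ controls the event that no connecting edge exists. -/

noncomputable section

namespace LongRange

/-! ### Independent events and the van den Berg–Kesten inequality. -/

section Configurations

variable {Ω ι : Type*}

/-- The random set of indices whose event occurs. -/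
def conf (A : ι → Set Ω) (ω : Ω) : Set ι := {i | ω ∈ A i}

/-- The `σ`-algebra generated by the events with index in `F`. -/
@[reducible] def confSigma (A : ι → Set Ω) (F : Set ι) : MeasurableSpace Ω :=
  ⨆ i ∈ F, MeasurableSpace.generateFrom {A i}

theorem measurableSet_confSigma (A : ι → Set Ω) {F : Set ι} {i : ι} (hi : i ∈ F) :
    MeasurableSet[confSigma A F] (A i) := by
  have h : MeasurableSpace.generateFrom {A i} ≤ confSigma A F :=
    le_iSup₂ (f := fun i (_ : i ∈ F) => MeasurableSpace.generateFrom {A i}) i hi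
  exact h _ (MeasurableSpace.measurableSet_generateFrom rfl)

theorem measurable_confSigma {β : Type*} [MeasurableSpace β] (A : ι → Set Ω) {F : Set ι}
    (hF : F.Finite) (f : Set ι → β) :
    Measurable[confSigma A F] (fun ω => f (conf A ω ∩ F)) := by
  have key : ∀ S : Set ι, MeasurableSet[confSigma A F] {ω | conf A ω ∩ F = S} := by
    intro S
    by_cases hS : S ⊆ F
    · have : {ω | conf A ω ∩ F = S} = ⋂ i ∈ F, {ω | ω ∈ A i ↔ i ∈ S} := by
        ext ω
        simp only [Set.mem_ofPred_eq, Set.mem_iInter, Set.ext_iff, conf, Set.mem_inter_iff]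
        constructor
        · intro h i hi
          simpa [hi] using h i
        · intro h i
          by_cases hi : i ∈ F
          · simpa [hi] using h i hi
          · have : i ∉ S := fun h' => hi (hS h')
            simp [hi, this]
      rw [this]
      refine MeasurableSet.biInter hF.countable fun i hi => ?_
      have hA := measurableSet_confSigma A hi
      by_cases hiS : i ∈ S
      · simpa [hiS] using hA
      · simp only [hiS, iff_false]
        exact hA.compl
    · have : {ω | conf A ω ∩ F = S} = ∅ := by
        ext ω
        simp only [Set.mem_ofPred_eq, Set.mem_empty_iff_false, iff_false]
        rintro rfl
        exact hS Set.inter_subset_right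
      rw [this]
      exact @MeasurableSet.empty _ (confSigma A F)
  refine fun s _ => ?_
  have hs : (fun ω => f (conf A ω ∩ F)) ⁻¹' s
      = ⋃ S ∈ {S | S ∈ F.powerset ∧ f S ∈ s}, {ω | conf A ω ∩ F = S} := by
    ext ω
    simp
  rw [hs]
  refine MeasurableSet.biUnion ?_ fun S _ => key S
  exact (hF.finite_subsets.subset fun S hS => hS.1).countable

variable [MeasurableSpace Ω] {μ : Measure Ω} {A : ι → Set Ω}

theorem confSigma_le (hA : ∀ i, MeasurableSet (A i)) (F : Set ι) :
    confSigma A F ≤ ‹MeasurableSpace Ω› := by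
  refine iSup₂_le fun i _ => MeasurableSpace.generateFrom_le ?_
  rintro _ rfl
  exact hA i

theorem measurableSet_conf_inter (hA : ∀ i, MeasurableSet (A i)) {F : Set ι} (hF : F.Finite)
    (P : Set ι → Prop) : MeasurableSet {ω | P (conf A ω ∩ F)} :=
  confSigma_le hA F _
    (measurable_confSigma A hF P (show MeasurableSet ({True} : Set Prop) from trivial) |>.congr
      (by ext; simp))

theorem indep_confSigma (hA : ∀ i, MeasurableSet (A i)) (hind : iIndepSet A μ) {F F' : Set ι}
    (hd : Disjoint F F') : Indep (confSigma A F) (confSigma A F') μ :=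
  indep_iSup_of_disjoint
    (fun i => MeasurableSpace.generateFrom_le (by rintro _ rfl; exact hA i))
    ((iIndepSet_iff_iIndep _ _).1 hind) hd

theorem lintegral_mul_conf (hA : ∀ i, MeasurableSet (A i)) (hind : iIndepSet A μ) {F F' : Set ι}
    (hF : F.Finite) (hF' : F'.Finite) (hd : Disjoint F F') (f g : Set ι → ℝ≥0∞) :
    ∫⁻ ω, f (conf A ω ∩ F) * g (conf A ω ∩ F') ∂μ
      = (∫⁻ ω, f (conf A ω ∩ F) ∂μ) * ∫⁻ ω, g (conf A ω ∩ F') ∂μ :=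
  lintegral_mul_eq_lintegral_mul_lintegral_of_independent_measurableSpace
    (confSigma_le hA F) (confSigma_le hA F') (indep_confSigma hA hind hd)
    (measurable_confSigma A hF f) (measurable_confSigma A hF' g)

/-- Disjoint occurrence of two properties of configurations. -/
def DisjOcc (P Q : Set ι → Prop) (S : Set ι) : Prop :=
  ∃ S₁ S₂, S₁ ⊆ S ∧ S₂ ⊆ S ∧ Disjoint S₁ S₂ ∧ P S₁ ∧ Q S₂

theorem monotone_disjOcc (P Q : Set ι → Prop) : Monotone (DisjOcc P Q) :=
  fun _ _ h ⟨S₁, S₂, h₁, h₂, h'⟩ => ⟨S₁, S₂, h₁.trans h, h₂.trans h, h'⟩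

theorem DisjOcc.mono {P Q P' Q' : Set ι → Prop} (hP : P ≤ P') (hQ : Q ≤ Q') {S : Set ι}
    (h : DisjOcc P Q S) : DisjOcc P' Q' S := by
  obtain ⟨S₁, S₂, h₁, h₂, hd, h₃, h₄⟩ := h
  exact ⟨S₁, S₂, h₁, h₂, hd, hP _ h₃, hQ _ h₄⟩

/-- Disjoint witnesses cannot both contain `a`. If neither does, monotonicity of `Q` allows `a` to
be given to the second one. -/
theorem DisjOcc.of_insert {P Q : Set ι → Prop} (hQ : Monotone Q) {a : ι}
    {S : Set ι} (h : DisjOcc P Q (insert a S)) :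
    DisjOcc (fun T => P (insert a T)) Q S ∨ DisjOcc P (fun T => Q (insert a T)) S := by
  obtain ⟨S₁, S₂, h₁, h₂, hd, h₃, h₄⟩ := h
  by_cases ha : a ∈ S₁
  · left
    refine ⟨S₁ \ {a}, S₂, ?_, ?_, hd.mono_left Set.sdiff_subset, ?_, h₄⟩
    · intro x hx
      exact (h₁ hx.1).resolve_left hx.2
    · intro x hx
      refine (h₂ hx).resolve_left ?_
      rintro rfl
      exact Set.disjoint_left.1 hd ha hx
    · simpa [Set.insert_eq_of_mem ha] using h₃
  · right
    refine ⟨S₁, S₂ \ {a}, ?_, ?_, hd.mono_right Set.sdiff_subset, h₃, ?_⟩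
    · intro x hx
      refine (h₁ hx).resolve_left ?_
      rintro rfl
      exact ha hx
    · intro x hx
      exact (h₂ hx.1).resolve_left hx.2
    · refine hQ ?_ h₄
      intro x hx
      by_cases hxa : x = a
      · exact Or.inl hxa
      · exact Or.inr ⟨hx, hxa⟩

theorem measureReal_conf_insert [IsProbabilityMeasure μ] (hA : ∀ i, MeasurableSet (A i))
    (hind : iIndepSet A μ) {F : Set ι} (hF : F.Finite) {a : ι} (ha : a ∉ F) (P : Set ι → Prop) :
    μ.real {ω | P (conf A ω ∩ insert a F)}
      = μ.real (A a) * μ.real {ω | P (insert a (conf A ω ∩ F))}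
        + (1 - μ.real (A a)) * μ.real {ω | P (conf A ω ∩ F)} := by
  have hm : ∀ P : Set ι → Prop, MeasurableSet[confSigma A F] {ω | P (conf A ω ∩ F)} := fun P =>
    (measurable_confSigma A hF P (show MeasurableSet ({True} : Set Prop) from trivial)).congr
      (by ext; simp)
  have hm' : MeasurableSet[confSigma A {a}] (A a) := measurableSet_confSigma A rfl
  have hI := (Indep_iff _ _ _).1
    (indep_confSigma hA hind (F := {a}) (F' := F) (by simpa using ha))
  have h1 := hI _ _ hm' (hm fun S => P (insert a S))
  have h0 := hI _ _ hm'.compl (hm P)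
  have hsplit : {ω | P (conf A ω ∩ insert a F)}
      = (A a ∩ {ω | P (insert a (conf A ω ∩ F))}) ∪ ((A a)ᶜ ∩ {ω | P (conf A ω ∩ F)}) := by
    ext ω
    by_cases hω : ω ∈ A a
    · have : conf A ω ∩ insert a F = insert a (conf A ω ∩ F) := by
        rw [Set.insert_inter_distrib, Set.insert_eq_of_mem (show a ∈ conf A ω from hω)]
      simp [hω, this]
    · have : conf A ω ∩ insert a F = conf A ω ∩ F := by
        rw [Set.inter_insert_of_notMem (show a ∉ conf A ω from hω)]
      simp [hω, this]
  have hdisj : Disjoint (A a ∩ {ω | P (insert a (conf A ω ∩ F))})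
      ((A a)ᶜ ∩ {ω | P (conf A ω ∩ F)}) :=
    disjoint_compl_right.mono Set.inter_subset_left Set.inter_subset_left
  rw [hsplit, measureReal_union hdisj ((hA a).compl.inter (confSigma_le hA F _ (hm P)))]
  rw [← probReal_compl_eq_one_sub (hA a)]
  simp only [Measure.real, h1, h0, ENNReal.toReal_mul]

/-- The van den Berg–Kesten inequality for finitely many independent events. -/
theorem measureReal_disjOcc_inter_le [IsProbabilityMeasure μ] (hA : ∀ i, MeasurableSet (A i))
    (hind : iIndepSet A μ) {F : Set ι} (hF : F.Finite) {P Q : Set ι → Prop} (hP : Monotone P)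
    (hQ : Monotone Q) :
    μ.real {ω | DisjOcc P Q (conf A ω ∩ F)}
      ≤ μ.real {ω | P (conf A ω ∩ F)} * μ.real {ω | Q (conf A ω ∩ F)} := by
  induction F, hF using Set.Finite.induction_on generalizing P Q with
  | empty =>
    simp only [Set.inter_empty]
    by_cases h : DisjOcc P Q ∅
    · obtain ⟨S₁, S₂, h₁, h₂, -, h₃, h₄⟩ := h
      have h₃' := hP h₁ h₃
      have h₄' := hQ h₂ h₄
      simp only [h₃', h₄', Set.ofPred_true, probReal_univ, mul_one]
      exact measureReal_le_one
    · simp only [h, Set.ofPred_false, measureReal_empty]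
      positivity
  | @insert a F ha hF ih =>
    have hins : Monotone (fun S : Set ι => insert a S) := fun _ _ h => Set.insert_subset_insert h
    have hP1 : Monotone (fun S => P (insert a S)) := hP.comp hins
    have hQ1 : Monotone (fun S => Q (insert a S)) := hQ.comp hins
    have hPle : P ≤ (fun S => P (insert a S)) := fun S => hP (Set.subset_insert a S)
    have hQle : Q ≤ (fun S => Q (insert a S)) := fun S => hQ (Set.subset_insert a S)
    rw [measureReal_conf_insert hA hind hF ha, measureReal_conf_insert hA hind hF ha P,
      measureReal_conf_insert hA hind hF ha Q]
    have hx := ih hP hQ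
    have hy := ih hP hQ1
    have hz := ih hP1 hQ
    have hw := ih hP1 hQ1
    have hmeas := fun R : Set ι → Prop => measurableSet_conf_inter hA hF R
    set p := μ.real (A a)
    have hp0 : 0 ≤ p := measureReal_nonneg
    have hp1 : p ≤ 1 := measureReal_le_one
    -- Two bounds for the case in which `a` occurs: `a` may be lent to both witnesses, or
    -- inclusion–exclusion applies to the question of which witness uses `a`. In the latter, the
    -- intersection contains the disjoint occurrence without `a`.
    have hUw : μ.real {ω | DisjOcc P Q (insert a (conf A ω ∩ F))}
        ≤ μ.real {ω | DisjOcc (fun S => P (insert a S)) (fun S => Q (insert a S))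
          (conf A ω ∩ F)} := by
      refine measureReal_mono fun ω hω => ?_
      rcases DisjOcc.of_insert hQ hω with h | h
      · exact h.mono le_rfl hQle
      · exact h.mono hPle le_rfl
    have hUyz : μ.real {ω | DisjOcc P Q (insert a (conf A ω ∩ F))}
        ≤ μ.real {ω | DisjOcc (fun S => P (insert a S)) Q (conf A ω ∩ F)}
          + μ.real {ω | DisjOcc P (fun S => Q (insert a S)) (conf A ω ∩ F)}
          - μ.real {ω | DisjOcc P Q (conf A ω ∩ F)} := by
      have hun := measureReal_union_add_inter (μ := μ)
        (s := {ω | DisjOcc (fun S => P (insert a S)) Q (conf A ω ∩ F)})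
        (hmeas (DisjOcc P (fun S => Q (insert a S))))
      have h1 : μ.real {ω | DisjOcc P Q (insert a (conf A ω ∩ F))}
          ≤ μ.real ({ω | DisjOcc (fun S => P (insert a S)) Q (conf A ω ∩ F)} ∪
            {ω | DisjOcc P (fun S => Q (insert a S)) (conf A ω ∩ F)}) :=
        measureReal_mono fun ω hω => DisjOcc.of_insert hQ hω
      have h2 : μ.real {ω | DisjOcc P Q (conf A ω ∩ F)}
          ≤ μ.real ({ω | DisjOcc (fun S => P (insert a S)) Q (conf A ω ∩ F)} ∩
            {ω | DisjOcc P (fun S => Q (insert a S)) (conf A ω ∩ F)}) :=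
        measureReal_mono fun ω hω =>
          ⟨DisjOcc.mono hPle le_rfl hω, DisjOcc.mono le_rfl hQle hω⟩
      linarith
    generalize μ.real {ω | DisjOcc P Q (insert a (conf A ω ∩ F))} = U at *
    generalize μ.real {ω | DisjOcc P Q (conf A ω ∩ F)} = x at *
    generalize μ.real {ω | P (conf A ω ∩ F)} = a0 at *
    generalize μ.real {ω | Q (conf A ω ∩ F)} = b0 at *
    generalize μ.real {ω | P (insert a (conf A ω ∩ F))} = a1 at *
    generalize μ.real {ω | Q (insert a (conf A ω ∩ F))} = b1 at *
    -- The two bounds on `U` are averaged with weights `1 - p` and `p`. The resulting `-p(1-p)x`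
    -- turns `(1-p)x` into `(1-p)²x`, which pairs with `(1-p)²a0b0` in the expanded product.
    have e1 : p * U ≤ p * ((1 - p) * (a1 * b0 + a0 * b1 - x) + p * (a1 * b1)) := by
      have i1 : U ≤ a1 * b0 + a0 * b1 - x := by linarith
      have i2 : U ≤ a1 * b1 := by linarith
      have j1 := mul_le_mul_of_nonneg_left i1 (sub_nonneg.2 hp1)
      have j2 := mul_le_mul_of_nonneg_left i2 hp0
      exact mul_le_mul_of_nonneg_left (by linarith) hp0
    have e2 : (1 - p) ^ 2 * x ≤ (1 - p) ^ 2 * (a0 * b0) :=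
      mul_le_mul_of_nonneg_left hx (sq_nonneg _)
    linarith

/-- A property of configurations that is decided by a finite sub-configuration. -/
def Finitary (P : Set ι → Prop) : Prop :=
  ∀ S, P S → ∃ T : Set ι, T.Finite ∧ T ⊆ S ∧ P T

theorem Finitary.disjOcc {P Q : Set ι → Prop} (hP : Finitary P) (hQ : Finitary Q) :
    Finitary (DisjOcc P Q) := by
  rintro S ⟨S₁, S₂, h₁, h₂, hd, h₃, h₄⟩
  obtain ⟨T₁, f₁, i₁, j₁⟩ := hP _ h₃
  obtain ⟨T₂, f₂, i₂, j₂⟩ := hQ _ h₄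
  exact ⟨T₁ ∪ T₂, f₁.union f₂, Set.union_subset (i₁.trans h₁) (i₂.trans h₂),
    T₁, T₂, Set.subset_union_left, Set.subset_union_right, hd.mono i₁ i₂, j₁, j₂⟩

omit [MeasurableSpace Ω] in
theorem setOf_conf_eq_iUnion {P : Set ι → Prop} (hP : Finitary P) (hPm : Monotone P) :
    {ω | P (conf A ω)} = ⋃ F : Finset ι, {ω | P (conf A ω ∩ F)} := by
  ext ω
  simp only [Set.mem_ofPred_eq, Set.mem_iUnion]
  constructor
  · intro h
    obtain ⟨T, hT, hTS, hPT⟩ := hP _ h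
    refine ⟨hT.toFinset, hPm ?_ hPT⟩
    simpa using hTS
  · rintro ⟨F, hF⟩
    exact hPm Set.inter_subset_left hF

/-- The van den Berg–Kesten inequality for countably many independent events and increasing
properties that are decided by finite sub-configurations. -/
theorem measure_disjOcc_le [Countable ι] [IsProbabilityMeasure μ] (hA : ∀ i, MeasurableSet (A i))
    (hind : iIndepSet A μ) {P Q : Set ι → Prop} (hP : Monotone P) (hQ : Monotone Q)
    (hPf : Finitary P) (hQf : Finitary Q) :
    μ {ω | DisjOcc P Q (conf A ω)} ≤ μ {ω | P (conf A ω)} * μ {ω | Q (conf A ω)} := by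
  classical
  -- Continuity from below along finite index sets reduces to the finite inequality.
  rw [setOf_conf_eq_iUnion (hPf.disjOcc hQf) (monotone_disjOcc P Q), Directed.measure_iUnion]
  · refine iSup_le fun F => ?_
    have h := measureReal_disjOcc_inter_le hA hind F.finite_toSet hP hQ
    have h' : μ {ω | DisjOcc P Q (conf A ω ∩ F)}
        ≤ μ {ω | P (conf A ω ∩ F)} * μ {ω | Q (conf A ω ∩ F)} := by
      rw [← ENNReal.toReal_le_toReal (measure_ne_top _ _)
        (ENNReal.mul_ne_top (measure_ne_top _ _) (measure_ne_top _ _)), ENNReal.toReal_mul]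
      exact h
    refine h'.trans ?_
    gcongr
    · exact fun h => hP Set.inter_subset_left h
    · exact fun h => hQ Set.inter_subset_left h
  · refine directed_of_isDirected_le fun F F' h => ?_
    intro ω hω
    exact monotone_disjOcc P Q (Set.inter_subset_inter_right _ (Finset.coe_subset.2 h)) hω

end Configurations

/-! ### Edges of the percolation graph as independent events. -/

section EdgeEvents

variable {d : ℕ} {Ω : Type*}

/-- The event that `e` is an edge of the percolation graph. -/
def edgeEvent (E : Ω → Set (Sym2 (Site d))) (e : Sym2 (Site d)) : Set Ω :=
  {ω | e ∈ (percGraph (E ω)).edgeSet}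

theorem conf_edgeEvent (E : Ω → Set (Sym2 (Site d))) (ω : Ω) :
    conf (edgeEvent E) ω = (percGraph (E ω)).edgeSet := rfl

theorem mem_edgeEvent {E : Ω → Set (Sym2 (Site d))} {e : Sym2 (Site d)} {ω : Ω} :
    ω ∈ edgeEvent E e ↔ e ∈ (latticeGraph d).edgeSet ∨ (e ∈ E ω ∧ ¬ e.IsDiag) := by
  change e ∈ (latticeGraph d ⊔ SimpleGraph.fromEdgeSet (E ω)).edgeSet ↔ _
  rw [SimpleGraph.edgeSet_sup, SimpleGraph.edgeSet_fromEdgeSet]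
  rfl

theorem edgeEvent_of_mem {E : Ω → Set (Sym2 (Site d))} {e : Sym2 (Site d)}
    (h : e ∈ (latticeGraph d).edgeSet) : edgeEvent E e = Set.univ := by
  ext ω
  simp [mem_edgeEvent, h]

theorem edgeEvent_of_isDiag {E : Ω → Set (Sym2 (Site d))} {e : Sym2 (Site d)}
    (h : e.IsDiag) : edgeEvent E e = ∅ := by
  ext ω
  have : e ∉ (latticeGraph d).edgeSet := fun h' => SimpleGraph.not_isDiag_of_mem_edgeSet _ h' h
  simp [mem_edgeEvent, h, this]

theorem edgeEvent_of_notMem {E : Ω → Set (Sym2 (Site d))} {e : Sym2 (Site d)}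
    (h : e ∉ (latticeGraph d).edgeSet) (h' : ¬ e.IsDiag) :
    edgeEvent E e = {ω | e ∈ E ω} := by
  ext ω
  simp [mem_edgeEvent, h, h']

variable [MeasurableSpace Ω] {q : Site d → ℝ≥0∞} {μ : Measure Ω} {E : Ω → Set (Sym2 (Site d))}

theorem IsLongRangePercolation.measurableSet_edgeEvent (hE : IsLongRangePercolation q μ E)
    (e : Sym2 (Site d)) : MeasurableSet (edgeEvent E e) := by
  by_cases h : e ∈ (latticeGraph d).edgeSet
  · simp [edgeEvent_of_mem h]
  by_cases h' : e.IsDiag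
  · simp [edgeEvent_of_isDiag h']
  · rw [edgeEvent_of_notMem h h']
    exact hE.measurableSet_edge e h'

/-- Lattice edges are certain and diagonal pairs impossible; adding such events to an independent
family keeps it independent. All of `Sym2` can thus serve as the index type. -/
theorem IsLongRangePercolation.iIndepSet_edgeEvent [IsProbabilityMeasure μ]
    (hE : IsLongRangePercolation q μ E) : iIndepSet (edgeEvent E) μ := by
  classical
  rw [iIndepSet_iff_meas_biInter hE.measurableSet_edgeEvent]
  intro t
  by_cases hd : ∃ e ∈ t, e.IsDiag
  · obtain ⟨e, he, hed⟩ := hd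
    rw [Finset.prod_eq_zero he (by simp [edgeEvent_of_isDiag hed])]
    refine measure_mono_null (Set.biInter_subset_of_mem he) ?_
    simp [edgeEvent_of_isDiag hed]
  · push Not at hd
    let t' : Finset {e : Sym2 (Site d) // ¬ e.IsDiag} :=
      (t.filter (· ∉ (latticeGraph d).edgeSet)).subtype _
    have h1 : ⋂ i ∈ t, edgeEvent E i = ⋂ i ∈ t', {ω | (i : Sym2 (Site d)) ∈ E ω} := by
      ext ω
      simp only [Set.mem_iInter, mem_edgeEvent, Set.mem_ofPred_eq, t', Finset.mem_subtype,
        Finset.mem_filter, Subtype.forall]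
      constructor
      · intro h e he ⟨het, hel⟩
        exact ((h e het).resolve_left hel).1
      · intro h e he
        by_cases hl : e ∈ (latticeGraph d).edgeSet
        · exact Or.inl hl
        · exact Or.inr ⟨h e (hd e he) ⟨he, hl⟩, hd e he⟩
    rw [h1, hE.indep.meas_biInter t']
    have h2 : ∏ i ∈ t, μ (edgeEvent E i)
        = ∏ i ∈ t.filter (· ∉ (latticeGraph d).edgeSet), μ (edgeEvent E i) := by
      rw [Finset.prod_filter]
      refine Finset.prod_congr rfl fun e _ => ?_
      split_ifs with h
      · rw [edgeEvent_of_mem h, measure_univ]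
      · rfl
    rw [h2, ← Finset.prod_subtype_of_mem (p := fun e : Sym2 (Site d) => ¬ e.IsDiag)
      (fun e => μ (edgeEvent E e)) (fun e he => hd e (Finset.mem_filter.1 he).1)]
    refine Finset.prod_congr rfl fun e he => ?_
    rw [edgeEvent_of_notMem _ e.2]
    exact (Finset.mem_filter.1 (Finset.mem_subtype.1 he)).2

theorem IsLongRangePercolation.edgeProb_le (hE : IsLongRangePercolation q μ E) {x y : Site d}
    (h : x ≠ y) : edgeProb (q (x - y)) ≤ μ (edgeEvent E s(x, y)) := by
  rw [← hE.prob_edge x y h]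
  refine measure_mono fun ω hω => ?_
  exact mem_edgeEvent.2 (Or.inr ⟨hω, by simpa using h⟩)

theorem IsLongRangePercolation.measure_edgeEvent_le [IsProbabilityMeasure μ]
    (hE : IsLongRangePercolation q μ E) {C s : ℝ} (hC : 1 ≤ C)
    (hq : ∀ x : Site d, x ≠ 0 → edgeProb (q x) ≤ ENNReal.ofReal (C * ‖x‖ ^ (-s)))
    {x y : Site d} (h : x ≠ y) :
    μ (edgeEvent E s(x, y)) ≤ ENNReal.ofReal (C * ‖x - y‖ ^ (-s)) := by
  by_cases hl : s(x, y) ∈ (latticeGraph d).edgeSet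
  -- A lattice edge is always present, but its endpoints are at sup-norm distance 1, so `1 ≤ C`
  -- makes the bound trivial.
  · have hsum : ∑ i, |x i - y i| = 1 := hl
    have hnorm : ‖x - y‖ ≤ 1 := by
      refine (pi_norm_le_iff_of_nonneg zero_le_one).2 fun i => ?_
      have h1 : |x i - y i| ≤ 1 := by
        rw [← hsum]
        exact Finset.single_le_sum (f := fun i => |x i - y i|) (fun _ _ => abs_nonneg _)
          (Finset.mem_univ i)
      rw [Pi.sub_apply, Int.norm_eq_abs]
      exact_mod_cast h1
    have hnorm' : ‖x - y‖ = 1 := by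
      refine le_antisymm hnorm ?_
      obtain ⟨i, hi⟩ := Function.ne_iff.1 h
      refine le_trans ?_ (norm_le_pi_norm _ i)
      rw [Pi.sub_apply, Int.norm_eq_abs]
      exact_mod_cast Int.one_le_abs (sub_ne_zero.2 hi)
    rw [hnorm', Real.one_rpow, mul_one]
    exact prob_le_one.trans (by simpa using hC)
  · rw [edgeEvent_of_notMem hl (by simpa using h), hE.prob_edge x y h]
    exact hq _ (sub_ne_zero.2 h)

end EdgeEvents

/-! ### Power-law bounds, in the sup norm, from the decay exponent. -/

section Decay

variable {d : ℕ}

theorem norm_le_euclNorm (x : Site d) : ‖x‖ ≤ euclNorm x := by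
  refine (pi_norm_le_iff_of_nonneg (Real.sqrt_nonneg _)).2 fun i => ?_
  rw [Int.norm_eq_abs]
  refine Real.le_sqrt_of_sq_le ?_
  rw [sq_abs]
  exact Finset.single_le_sum (f := fun i => (x i : ℝ) ^ 2) (fun _ _ => sq_nonneg _)
    (Finset.mem_univ i)

theorem euclNorm_le (x : Site d) : euclNorm x ≤ d * ‖x‖ := by
  refine Real.sqrt_le_iff.2 ⟨by positivity, ?_⟩
  have h : ∀ i ∈ Finset.univ, (x i : ℝ) ^ 2 ≤ ‖x‖ ^ 2 := fun i _ => by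
    rw [← sq_abs, ← Int.norm_eq_abs]
    exact pow_le_pow_left₀ (norm_nonneg _) (norm_le_pi_norm x i) 2
  have h2 := Finset.sum_le_sum h
  rw [Finset.sum_const, Finset.card_univ, Fintype.card_fin, nsmul_eq_mul] at h2
  refine h2.trans ?_
  rw [mul_pow]
  gcongr
  exact_mod_cast Nat.le_self_pow two_ne_zero d

theorem eventually_siteAtInfty {p : Site d → Prop} (h : ∀ᶠ x in siteAtInfty d, p x) :
    ∃ R : ℝ, ∀ x : Site d, R ≤ ‖x‖ → p x := by
  obtain ⟨t, ht, hp⟩ := h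
  obtain ⟨R, hR⟩ := mem_atTop_sets.1 ht
  exact ⟨R, fun x hx => hp (hR _ (hx.trans (norm_le_euclNorm x)))⟩

theorem edgeProb_le_one (t : ℝ≥0∞) : edgeProb t ≤ 1 := tsub_le_self

theorem one_sub_edgeProb (t : ℝ≥0∞) : 1 - edgeProb t = EReal.exp (-(t : EReal)) := by
  refine ENNReal.sub_sub_cancel ENNReal.one_ne_top ?_
  rw [← EReal.exp_zero]
  exact EReal.exp_le_exp_iff.2 (by simpa using EReal.coe_ennreal_nonneg t)

theorem edgeProb_le_self (t : ℝ≥0∞) : edgeProb t ≤ t := by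
  induction t with
  | top => exact le_top
  | coe t =>
    have h : EReal.exp (-(((t : ℝ≥0∞)) : EReal)) = ENNReal.ofReal (Real.exp (-(t : ℝ))) := by
      rw [← EReal.exp_coe]; rfl
    rw [edgeProb, h, tsub_le_iff_right]
    have h2 : (t : ℝ≥0∞) = ENNReal.ofReal t := by simp
    rw [h2, ← ENNReal.ofReal_add t.coe_nonneg (Real.exp_pos (-(t : ℝ))).le, ← ENNReal.ofReal_one]
    refine ENNReal.ofReal_le_ofReal ?_
    have := Real.add_one_le_exp (-(t : ℝ))
    linarith

theorem log_ofReal_rpow {r s : ℝ} (hr : 0 < r) :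
    ENNReal.log (ENNReal.ofReal (r ^ s)) = ((s * Real.log r : ℝ) : EReal) := by
  rw [ENNReal.log_ofReal_of_pos (Real.rpow_pos_of_pos hr s), Real.log_rpow hr]

theorem HasDecayExponent.exists_edgeProb_le {q : Site d → ℝ≥0∞} {s s' : ℝ}
    (h : HasDecayExponent q s) (hs : s' < s) (hs' : 0 ≤ s') :
    ∃ C : ℝ, 1 ≤ C ∧ ∀ x : Site d, x ≠ 0 → edgeProb (q x) ≤ ENNReal.ofReal (C * ‖x‖ ^ (-s')) := by
  have h1 : ∀ᶠ x in siteAtInfty d,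
      ENNReal.log (q x) / ((Real.log (euclNorm x) : ℝ) : EReal) < ((-s' : ℝ) : EReal) :=
    h.eventually (gt_mem_nhds (by exact_mod_cast neg_lt_neg hs))
  obtain ⟨R, hR⟩ := eventually_siteAtInfty h1
  -- This constant makes the bound at least 1 for `‖x‖ < max R 2`; the 2 keeps the logarithm
  -- positive beyond.
  refine ⟨(max R 2) ^ s', Real.one_le_rpow (le_max_of_le_right one_le_two) hs', fun x hx => ?_⟩
  have hxpos : 0 < ‖x‖ := norm_pos_iff.2 hx
  rcases le_or_gt (max R 2) ‖x‖ with hle | hlt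
  · have hx2 : 2 ≤ ‖x‖ := (le_max_right _ _).trans hle
    have he : 2 ≤ euclNorm x := hx2.trans (norm_le_euclNorm x)
    have hlog : 0 < Real.log (euclNorm x) := Real.log_pos (by linarith)
    have h2 := hR x ((le_max_left _ _).trans hle)
    rw [EReal.div_lt_iff (by exact_mod_cast hlog) (EReal.coe_ne_top _), ← EReal.coe_mul,
      ← log_ofReal_rpow (by linarith), ENNReal.log_lt_log_iff] at h2
    refine (edgeProb_le_self _).trans (h2.le.trans (ENNReal.ofReal_le_ofReal ?_))
    have h3 : euclNorm x ^ (-s') ≤ ‖x‖ ^ (-s') :=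
      Real.rpow_le_rpow_of_nonpos hxpos (norm_le_euclNorm x) (by linarith)
    refine h3.trans (le_mul_of_one_le_left (by positivity) ?_)
    exact Real.one_le_rpow (le_max_of_le_right one_le_two) hs'
  · refine (edgeProb_le_one _).trans ?_
    rw [← ENNReal.ofReal_one]
    refine ENNReal.ofReal_le_ofReal ?_
    rw [Real.rpow_neg hxpos.le, ← div_eq_mul_inv, one_le_div (by positivity)]
    exact Real.rpow_le_rpow hxpos.le hlt.le hs'

theorem HasDecayExponent.exists_le {q : Site d → ℝ≥0∞} {s s' : ℝ} (hd : 0 < d)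
    (h : HasDecayExponent q s) (hs : s < s') (hs0 : 0 ≤ s) :
    ∃ c R : ℝ, 0 < c ∧ ∀ x : Site d, R ≤ ‖x‖ → ENNReal.ofReal (c * ‖x‖ ^ (-s')) ≤ q x := by
  have h1 : ∀ᶠ x in siteAtInfty d,
      ((-s' : ℝ) : EReal) < ENNReal.log (q x) / ((Real.log (euclNorm x) : ℝ) : EReal) :=
    h.eventually (lt_mem_nhds (by exact_mod_cast neg_lt_neg hs))
  obtain ⟨R, hR⟩ := eventually_siteAtInfty h1
  have hd' : (0 : ℝ) < d := by exact_mod_cast hd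
  refine ⟨(d : ℝ) ^ (-s'), max R 2, by positivity, fun x hx => ?_⟩
  have hx2 : 2 ≤ ‖x‖ := (le_max_right _ _).trans hx
  have he : 2 ≤ euclNorm x := hx2.trans (norm_le_euclNorm x)
  have hlog : 0 < Real.log (euclNorm x) := Real.log_pos (by linarith)
  have h2 := hR x ((le_max_left _ _).trans hx)
  rw [EReal.lt_div_iff (by exact_mod_cast hlog) (EReal.coe_ne_top _), ← EReal.coe_mul,
    ← log_ofReal_rpow (by linarith), ENNReal.log_lt_log_iff] at h2
  refine le_trans (ENNReal.ofReal_le_ofReal ?_) h2.le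
  rw [← Real.mul_rpow hd'.le (norm_nonneg _)]
  exact Real.rpow_le_rpow_of_nonpos (by linarith) (euclNorm_le x) (by linarith)

end Decay

/-! ### Short walks and their long edges. -/

section Paths

variable {V : Type*}

/-- The property that `x` and `y` are joined by a walk with at most `n` steps along `S`. -/
def Conn (n : ℕ) (x y : V) (S : Set (Sym2 V)) : Prop :=
  ∃ p : (SimpleGraph.fromEdgeSet S).Walk x y, p.length ≤ n

theorem monotone_conn (n : ℕ) (x y : V) : Monotone (Conn n x y) := by
  rintro S T h ⟨p, hp⟩
  exact ⟨p.mapLe (SimpleGraph.fromEdgeSet_mono h), by simpa using hp⟩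

theorem conn_of_edges_subset {G : SimpleGraph V} {x y : V} (p : G.Walk x y)
    {S : Set (Sym2 V)} (h : ∀ e ∈ p.edges, e ∈ S) : Conn p.length x y S := by
  refine ⟨p.transfer _ fun e he => ?_, by simp⟩
  rw [SimpleGraph.edgeSet_fromEdgeSet]
  exact ⟨h e he, G.not_isDiag_of_mem_edgeSet (p.edges_subset_edgeSet he)⟩

theorem mem_of_mem_edges {S : Set (Sym2 V)} {x y : V} (p : (SimpleGraph.fromEdgeSet S).Walk x y)
    {e : Sym2 V} (he : e ∈ p.edges) : e ∈ S := by
  have := p.edges_subset_edgeSet he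
  rw [SimpleGraph.edgeSet_fromEdgeSet] at this
  exact this.1

theorem finitary_conn (n : ℕ) (x y : V) : Finitary (Conn n x y) := by
  rintro S ⟨p, hp⟩
  refine ⟨{e | e ∈ p.edges}, p.edges.finite_toSet, fun e he => mem_of_mem_edges p he, ?_⟩
  obtain ⟨p', hp'⟩ := conn_of_edges_subset p (S := {e | e ∈ p.edges}) fun e he => he
  exact ⟨p', hp'.trans hp⟩

theorem conn_symm {n : ℕ} {x y : V} {S : Set (Sym2 V)} (h : Conn n x y S) : Conn n y x S := by
  obtain ⟨p, hp⟩ := h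
  exact ⟨p.reverse, by simpa using hp⟩

theorem conn_edgeSet_iff {G : SimpleGraph V} {n : ℕ} {x y : V} :
    Conn n x y G.edgeSet ↔ G.edist x y ≤ n := by
  rw [Conn, SimpleGraph.fromEdgeSet_edgeSet]
  constructor
  · rintro ⟨p, hp⟩
    exact p.edist_le.trans (by exact_mod_cast hp)
  · intro h
    obtain ⟨p, hp⟩ := (SimpleGraph.reachable_of_edist_ne_top
      (ne_top_of_le_ne_top (ENat.natCast_ne_top n) h)).exists_walk_length_eq_edist
    rw [← hp] at h
    exact ⟨p, by exact_mod_cast h⟩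

theorem exists_long_edge_of_walk [SeminormedAddCommGroup V] {G : SimpleGraph V} {x y : V}
    (p : G.Walk x y) {ℓ : ℝ} (h : p.length * ℓ < ‖x - y‖) :
    ∃ (u v : V) (huv : G.Adj u v) (p₁ : G.Walk x u) (p₂ : G.Walk v y),
      p = p₁.append (SimpleGraph.Walk.cons huv p₂) ∧ ℓ < ‖u - v‖ := by
  induction p with
  | nil => simp at h
  | @cons a b c hab p ih =>
    by_cases hl : ℓ < ‖a - b‖
    · exact ⟨a, b, hab, SimpleGraph.Walk.nil, p, rfl, hl⟩
    · have htri : ‖a - c‖ ≤ ‖a - b‖ + ‖b - c‖ := norm_sub_le_norm_sub_add_norm_sub a b c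
      rw [SimpleGraph.Walk.length_cons] at h
      push_cast at h
      obtain ⟨u, v, huv, p₁, p₂, rfl, hlt⟩ := ih (by linarith)
      exact ⟨u, v, huv, SimpleGraph.Walk.cons hab p₁, p₂, rfl, hlt⟩

/-- A path from `x` to `y` with at most `n` steps has a long step, and the parts before and after
that step use disjoint sets of edges. -/
theorem Conn.exists_disjOcc [SeminormedAddCommGroup V] {n : ℕ} {x y : V} {S : Set (Sym2 V)}
    (h : Conn n x y S) (hxy : 0 < ‖x - y‖) :
    ∃ k ∈ Finset.range n, ∃ u v : V, ‖x - y‖ / (2 * n) < ‖u - v‖ ∧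
      DisjOcc (Conn k x u) (DisjOcc (fun T => s(u, v) ∈ T) (Conn (n - 1 - k) v y)) S := by
  classical
  obtain ⟨p₀, hp₀⟩ := h
  -- In a simple path no edge repeats, which is what makes the three pieces edge-disjoint.
  set p := p₀.bypass
  have hpl : p.length ≤ n := (p₀.length_bypass_le_length).trans hp₀
  have hp : p.edges.Nodup := p₀.bypass_isPath.isTrail.edges_nodup
  -- The 2 makes the pigeonhole inequality strict. For `n = 0` the quotient is 0 by convention.
  have hlen : p.length * (‖x - y‖ / (2 * n)) < ‖x - y‖ := by
    rcases Nat.eq_zero_or_pos n with rfl | hn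
    · simpa using hxy
    · have hn' : (0 : ℝ) < n := by exact_mod_cast hn
      have hpl' : (p.length : ℝ) ≤ n := by exact_mod_cast hpl
      calc p.length * (‖x - y‖ / (2 * n)) ≤ n * (‖x - y‖ / (2 * n)) := by gcongr
        _ = ‖x - y‖ / 2 := by field_simp
        _ < ‖x - y‖ := by linarith
  obtain ⟨u, v, huv, p₁, p₂, hpp, hlt⟩ := exists_long_edge_of_walk p hlen
  rw [hpp, SimpleGraph.Walk.edges_append, SimpleGraph.Walk.edges_cons] at hp
  rw [hpp, SimpleGraph.Walk.length_append, SimpleGraph.Walk.length_cons] at hpl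
  have hp' := List.nodup_append.1 hp
  have hp'' := List.nodup_cons.1 hp'.2.1
  refine ⟨p₁.length, Finset.mem_range.2 (by omega), u, v, hlt, {e | e ∈ p₁.edges},
    insert s(u, v) {e | e ∈ p₂.edges}, fun e he => mem_of_mem_edges _ he, ?_, ?_,
    conn_of_edges_subset p₁ fun e he => he, {s(u, v)}, {e | e ∈ p₂.edges}, ?_, ?_, ?_, rfl, ?_⟩
  · refine Set.insert_subset ?_ fun e he => mem_of_mem_edges _ he
    exact ((SimpleGraph.fromEdgeSet_adj S).1 huv).1
  · refine Set.disjoint_left.2 fun e he he' => ?_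
    exact hp'.2.2 e he e (by simpa using he') rfl
  · simp
  · exact Set.subset_insert _ _
  · simpa using hp''.1
  · obtain ⟨w, hw⟩ := conn_of_edges_subset p₂ (S := {e | e ∈ p₂.edges}) fun e he => he
    exact ⟨w, hw.trans (by omega)⟩

end Paths

/-! ### Power sums over the lattice. -/

section LatticeSums

variable {d : ℕ}

theorem summable_norm_rpow_site {r : ℝ} (hr : (d : ℝ) < r) :
    Summable fun z : Site d => ‖z‖ ^ (-r) := by
  let b := Pi.basisFun ℝ (Fin d)
  let L := Submodule.span ℤ (Set.range b)
  have hrank : Module.finrank ℤ L = d := by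
    rw [ZLattice.rank ℝ L]
    simp
  have hmem : ∀ z : Site d, (fun i => (z i : ℝ)) ∈ L := fun z => by
    refine (b.mem_span_iff_repr_mem ℤ _).2 fun i => ?_
    exact ⟨z i, by simp [b]⟩
  have hinj : Function.Injective (fun z : Site d => (⟨fun i => (z i : ℝ), hmem z⟩ : L)) := by
    intro z w h
    funext i
    have : (z i : ℝ) = w i := congrFun (Subtype.ext_iff.1 h) i
    exact_mod_cast this
  have hs := (ZLattice.summable_norm_rpow L (-r) (by rw [hrank]; linarith)).comp_injective hinj
  refine hs.congr fun z => ?_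
  have : ‖(⟨fun i => (z i : ℝ), hmem z⟩ : L)‖ = ‖z‖ := by
    change ‖(fun i => (z i : ℝ))‖ = ‖z‖
    simp only [Pi.norm_def]
    congr 2
  simp only [Function.comp_apply, this]

theorem tsum_ofReal_norm_rpow_ne_top {r : ℝ} (hr : (d : ℝ) < r) :
    ∑' z : Site d, ENNReal.ofReal (‖z‖ ^ (-r)) ≠ ∞ :=
  (summable_norm_rpow_site hr).tsum_ofReal_ne_top

/-- Interpolates between a power-law bound and the trivial bound 1 for a probability: the smallest
admissible `t` gives the weakest dependence on the prefactor. -/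
theorem min_one_le_rpow {a t : ℝ} (ha : 0 ≤ a) (ht : 0 < t) (ht1 : t ≤ 1) : min 1 a ≤ a ^ t := by
  rcases le_total 1 a with h | h
  · rw [min_eq_left h]
    exact Real.one_le_rpow h ht.le
  · rw [min_eq_right h]
    exact Real.self_le_rpow_of_le_one ha h ht1

/-- Summing a probability bounded by `a |z|^{-s}` over the lattice. -/
theorem tsum_le_of_le_rpow {f : Site d → ℝ≥0∞} {a s t : ℝ} (ha : 0 ≤ a) (ht : 0 < t) (ht1 : t ≤ 1)
    (hf1 : ∀ z, f z ≤ 1) (hf : ∀ z, z ≠ 0 → f z ≤ ENNReal.ofReal (a * ‖z‖ ^ (-s))) :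
    ∑' z, f z ≤ 1 + ENNReal.ofReal (a ^ t) * ∑' z : Site d, ENNReal.ofReal (‖z‖ ^ (-(s * t))) := by
  rw [← ENNReal.tsum_mul_left]
  have h : ∀ z, f z ≤ (if z = 0 then 1 else 0)
      + ENNReal.ofReal (a ^ t) * ENNReal.ofReal (‖z‖ ^ (-(s * t))) := by
    intro z
    by_cases hz : z = 0
    · simp only [hz, if_true]
      exact (hf1 0).trans le_self_add
    · simp only [hz, if_false, zero_add]
      rw [← ENNReal.ofReal_mul (by positivity)]
      have h1 : f z ≤ ENNReal.ofReal (min 1 (a * ‖z‖ ^ (-s))) := by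
        rcases le_total 1 (a * ‖z‖ ^ (-s)) with h | h
        · rw [min_eq_left h]; simpa using hf1 z
        · rw [min_eq_right h]; exact hf z hz
      refine h1.trans (ENNReal.ofReal_le_ofReal ?_)
      refine (min_one_le_rpow (by positivity) ht ht1).trans_eq ?_
      rw [Real.mul_rpow ha (by positivity), ← Real.rpow_mul (norm_nonneg _), neg_mul]
  refine (ENNReal.tsum_le_tsum h).trans ?_
  rw [ENNReal.tsum_add]
  gcongr
  rw [tsum_ite_eq]

end LatticeSums

/-! ### Balls are contained in boxes: expected volume of intrinsic balls. -/

section Growth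

variable {d : ℕ} {Ω : Type*} [MeasurableSpace Ω] {q : Site d → ℝ≥0∞} {μ : Measure Ω}
  {E : Ω → Set (Sym2 (Site d))}

/-- The probability that the graph distance of `x` and `y` is at most `n`. -/
def connProb (μ : Measure Ω) (E : Ω → Set (Sym2 (Site d))) (n : ℕ) (x y : Site d) : ℝ≥0∞ :=
  μ {ω | Conn n x y (conf (edgeEvent E) ω)}

theorem connProb_comm (n : ℕ) (x y : Site d) : connProb μ E n x y = connProb μ E n y x := by
  unfold connProb
  congr 1
  ext ω
  exact ⟨conn_symm, conn_symm⟩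

theorem connProb_le_one [IsProbabilityMeasure μ] (n : ℕ) (x y : Site d) :
    connProb μ E n x y ≤ 1 := prob_le_one

theorem finitary_mem {ι : Type*} (a : ι) : Finitary (fun T : Set ι => a ∈ T) :=
  fun _ h => ⟨{a}, Set.finite_singleton a, Set.singleton_subset_iff.2 h, rfl⟩

theorem monotone_mem {ι : Type*} (a : ι) : Monotone (fun T : Set ι => a ∈ T) :=
  fun _ _ h h' => h h'

/-- Union bound over the position `k` and the endpoints of the long edge, then two uses of van den
Berg–Kesten. The edge probability is bounded uniformly, so the sums over `u` and `v` decouple into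
two expected volumes. -/
theorem IsLongRangePercolation.connProb_le [IsProbabilityMeasure μ]
    (hE : IsLongRangePercolation q μ E) {C s : ℝ} (hC : 1 ≤ C) (hs : 0 ≤ s)
    (hq : ∀ x : Site d, x ≠ 0 → edgeProb (q x) ≤ ENNReal.ofReal (C * ‖x‖ ^ (-s)))
    {n : ℕ} {M : ℕ → ℝ≥0∞} (hM : ∀ k < n, ∀ x, ∑' y, connProb μ E k x y ≤ M k)
    {x y : Site d} (h : x ≠ y) :
    connProb μ E n x y ≤ ∑ k ∈ Finset.range n,
      ENNReal.ofReal (C * (‖x - y‖ / (2 * n)) ^ (-s)) * (M k * M (n - 1 - k)) := by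
  have hxy : 0 < ‖x - y‖ := norm_pos_iff.2 (sub_ne_zero.2 h)
  set b := ENNReal.ofReal (C * (‖x - y‖ / (2 * n)) ^ (-s))
  have hsub : {ω | Conn n x y (conf (edgeEvent E) ω)} ⊆
      ⋃ k ∈ Finset.range n, ⋃ u, ⋃ v, {ω | ‖x - y‖ / (2 * n) < ‖u - v‖ ∧
        DisjOcc (Conn k x u) (DisjOcc (fun T => s(u, v) ∈ T) (Conn (n - 1 - k) v y))
          (conf (edgeEvent E) ω)} := by
    intro ω hω
    obtain ⟨k, hk, u, v, h1, h2⟩ := Conn.exists_disjOcc hω hxy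
    simp only [Set.mem_iUnion]
    exact ⟨k, hk, u, v, h1, h2⟩
  have hbound : ∀ k ∈ Finset.range n, ∀ u v, μ {ω | ‖x - y‖ / (2 * n) < ‖u - v‖ ∧
        DisjOcc (Conn k x u) (DisjOcc (fun T => s(u, v) ∈ T) (Conn (n - 1 - k) v y))
          (conf (edgeEvent E) ω)}
      ≤ connProb μ E k x u * (b * connProb μ E (n - 1 - k) v y) := by
    intro k hk u v
    have hn : (0 : ℝ) < n := by
      have := Finset.mem_range.1 hk
      exact_mod_cast (Nat.zero_le k).trans_lt this
    by_cases hl : ‖x - y‖ / (2 * n) < ‖u - v‖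
    · simp only [hl, true_and]
      refine (measure_disjOcc_le hE.measurableSet_edgeEvent hE.iIndepSet_edgeEvent
        (monotone_conn _ _ _) (monotone_disjOcc _ _) (finitary_conn _ _ _)
        ((finitary_mem _).disjOcc (finitary_conn _ _ _))).trans ?_
      refine mul_le_mul_right ?_ _
      refine (measure_disjOcc_le hE.measurableSet_edgeEvent hE.iIndepSet_edgeEvent
        (monotone_mem _) (monotone_conn _ _ _) (finitary_mem _) (finitary_conn _ _ _)).trans ?_
      refine mul_le_mul_left ?_ _
      have huv : u ≠ v := by
        rintro rfl
        simp only [sub_self, norm_zero] at hl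
        exact absurd hl (not_lt.2 (by positivity))
      refine (hE.measure_edgeEvent_le hC hq huv).trans (ENNReal.ofReal_le_ofReal ?_)
      refine mul_le_mul_of_nonneg_left ?_ (by linarith)
      exact Real.rpow_le_rpow_of_nonpos (by positivity) hl.le (by linarith)
    · simp [hl]
  calc connProb μ E n x y
      ≤ ∑ k ∈ Finset.range n, ∑' u, ∑' v,
          connProb μ E k x u * (b * connProb μ E (n - 1 - k) v y) := by
        refine (measure_mono hsub).trans ((measure_biUnion_finset_le _ _).trans ?_)
        refine Finset.sum_le_sum fun k hk => (measure_iUnion_le _).trans ?_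
        refine ENNReal.tsum_le_tsum fun u => (measure_iUnion_le _).trans ?_
        exact ENNReal.tsum_le_tsum fun v => hbound k hk u v
    _ ≤ _ := by
        refine Finset.sum_le_sum fun k hk => ?_
        have hk' := Finset.mem_range.1 hk
        simp_rw [ENNReal.tsum_mul_left, ENNReal.tsum_mul_right]
        have h1 := hM k hk' x
        have h2 := hM (n - 1 - k) (by omega) y
        simp_rw [connProb_comm _ y] at h2
        calc _ ≤ M k * (b * M (n - 1 - k)) := by gcongr
          _ = _ := by ring

/-- Concavity at the midpoint: the worst split of the length is into halves. The factor `2 ^ (1 -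
θ)` is the source of the 2 in `Δ`. -/
theorem add_rpow_le_two_rpow {a b θ : ℝ} (ha : 0 ≤ a) (hb : 0 ≤ b) (hθ : 0 ≤ θ) (hθ1 : θ ≤ 1) :
    a ^ θ + b ^ θ ≤ 2 ^ (1 - θ) * (a + b) ^ θ := by
  have h := (Real.concaveOn_rpow hθ hθ1).2 ha hb (show (0 : ℝ) ≤ 1 / 2 by norm_num)
    (show (0 : ℝ) ≤ 1 / 2 by norm_num) (by norm_num)
  simp only [smul_eq_mul] at h
  have h2 : 1 / 2 * a + 1 / 2 * b = (a + b) / 2 := by ring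
  rw [h2, Real.div_rpow (by positivity) (by norm_num)] at h
  rw [Real.rpow_sub two_pos, Real.rpow_one]
  have h3 : (0 : ℝ) < 2 ^ θ := by positivity
  calc a ^ θ + b ^ θ = 2 * (1 / 2 * a ^ θ + 1 / 2 * b ^ θ) := by ring
    _ ≤ 2 * ((a + b) ^ θ / 2 ^ θ) := by gcongr
    _ = _ := by ring

/-- The coefficient of the power-law bound on the probability of a short connection. -/
def connCoeff (C s K θ : ℝ) (n : ℝ) : ℝ :=
  C * 2 ^ s * n ^ (1 + s) * Real.exp (K * (2 ^ (1 - θ) * n ^ θ))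

theorem IsLongRangePercolation.connProb_le_of_tsum_le [IsProbabilityMeasure μ]
    (hE : IsLongRangePercolation q μ E) {C s K θ : ℝ} (hC : 1 ≤ C) (hs : 0 ≤ s) (hK : 0 ≤ K)
    (hθ : 0 < θ) (hθ1 : θ ≤ 1)
    (hq : ∀ x : Site d, x ≠ 0 → edgeProb (q x) ≤ ENNReal.ofReal (C * ‖x‖ ^ (-s)))
    {n : ℕ} (hM : ∀ k < n, ∀ x, ∑' y, connProb μ E k x y
      ≤ ENNReal.ofReal (Real.exp (K * (k : ℝ) ^ θ)))
    {x y : Site d} (h : x ≠ y) :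
    connProb μ E n x y ≤ ENNReal.ofReal (connCoeff C s K θ n * ‖x - y‖ ^ (-s)) := by
  refine (hE.connProb_le hC hs hq hM h).trans ?_
  rcases Nat.eq_zero_or_pos n with rfl | hn
  · simp
  have hn' : (0 : ℝ) < n := by exact_mod_cast hn
  have hxy : 0 < ‖x - y‖ := norm_pos_iff.2 (sub_ne_zero.2 h)
  have hterm : ∀ k ∈ Finset.range n,
      ENNReal.ofReal (C * (‖x - y‖ / (2 * n)) ^ (-s)) *
        (ENNReal.ofReal (Real.exp (K * (k : ℝ) ^ θ)) *
          ENNReal.ofReal (Real.exp (K * ((n - 1 - k : ℕ) : ℝ) ^ θ)))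
      ≤ ENNReal.ofReal (C * (‖x - y‖ / (2 * n)) ^ (-s)
          * Real.exp (K * (2 ^ (1 - θ) * (n : ℝ) ^ θ))) := by
    intro k hk
    have hk' := Finset.mem_range.1 hk
    rw [← ENNReal.ofReal_mul (Real.exp_pos _).le, ← Real.exp_add,
      ← ENNReal.ofReal_mul (by positivity)]
    refine ENNReal.ofReal_le_ofReal ?_
    gcongr
    rw [← mul_add]
    refine mul_le_mul_of_nonneg_left ?_ hK
    refine (add_rpow_le_two_rpow (by positivity) (by positivity) hθ.le hθ1).trans ?_
    gcongr
    have : k + (n - 1 - k) ≤ n := by omega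
    exact_mod_cast this
  refine (Finset.sum_le_sum hterm).trans ?_
  rw [Finset.sum_const, Finset.card_range, nsmul_eq_mul, ← ENNReal.ofReal_natCast,
    ← ENNReal.ofReal_mul hn'.le]
  refine ENNReal.ofReal_le_ofReal (le_of_eq ?_)
  rw [connCoeff, Real.div_rpow hxy.le (by positivity), Real.mul_rpow two_pos.le hn'.le,
    Real.rpow_add hn', Real.rpow_one, Real.rpow_neg hn'.le, Real.rpow_neg two_pos.le]
  field_simp

theorem tsum_sub_site (f : Site d → ℝ≥0∞) (x : Site d) : ∑' y, f (x - y) = ∑' z, f z :=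
  (Equiv.subLeft x).tsum_eq f

/-- The expected volume of the intrinsic ball grows at most like a stretched exponential. -/
theorem IsLongRangePercolation.exists_tsum_connProb_le [IsProbabilityMeasure μ]
    (hE : IsLongRangePercolation q μ E) {C s t θ : ℝ} (hC : 1 ≤ C) (hs : 0 ≤ s)
    (hθ : 0 < θ) (hθ1 : θ ≤ 1) (ht : 0 < t) (ht1 : t ≤ 1) (hst : (d : ℝ) < s * t)
    (hβ : t * 2 ^ (1 - θ) < 1)
    (hq : ∀ x : Site d, x ≠ 0 → edgeProb (q x) ≤ ENNReal.ofReal (C * ‖x‖ ^ (-s))) :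
    ∃ K : ℝ, 0 ≤ K ∧ ∀ (n : ℕ) (x : Site d),
      ∑' y, connProb μ E n x y ≤ ENNReal.ofReal (Real.exp (K * (n : ℝ) ^ θ)) := by
  set S := (∑' z : Site d, ENNReal.ofReal (‖z‖ ^ (-(s * t)))).toReal
  have hS : ∑' z : Site d, ENNReal.ofReal (‖z‖ ^ (-(s * t))) = ENNReal.ofReal S :=
    (ENNReal.ofReal_toReal (tsum_ofReal_norm_rpow_ne_top hst)).symm
  have hS0 : 0 ≤ S := ENNReal.toReal_nonneg
  set β := t * 2 ^ (1 - θ)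
  set B := 1 + (C * 2 ^ s) ^ t * S
  have hB : 1 ≤ B := le_add_of_nonneg_right (by positivity)
  -- Fixed point of the induction: `K` is multiplied by `β < 1`, and the other two terms pay for the
  -- constant `B` and for the power of `n`.
  set K := (Real.log B + (1 + s) * t / θ) / (1 - β)
  have hK : 0 ≤ K :=
    div_nonneg (add_nonneg (Real.log_nonneg hB) (by positivity)) (by linarith)
  have hKeq : Real.log B + (1 + s) * t / θ + K * β = K := by
    have : K * (1 - β) = Real.log B + (1 + s) * t / θ := div_mul_cancel₀ _ (by linarith)
    linarith
  refine ⟨K, hK, fun n => ?_⟩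
  induction n using Nat.strong_induction_on with
  | _ n ih =>
  intro x
  rcases Nat.eq_zero_or_pos n with rfl | hn
  · have h0 : ∀ y, connProb μ E 0 x y ≤ if y = x then 1 else 0 := by
      intro y
      split_ifs with hy
      · exact connProb_le_one _ _ _
      · refine (measure_mono_null (t := ∅) ?_ measure_empty).le
        rintro ω ⟨p, hp⟩
        exact hy (SimpleGraph.Walk.eq_of_length_eq_zero (Nat.le_zero.1 hp)).symm
    refine (ENNReal.tsum_le_tsum h0).trans ?_
    rw [tsum_ite_eq]
    simp [Real.zero_rpow hθ.ne']
  have hn1 : (1 : ℝ) ≤ n := by exact_mod_cast hn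
  have hn0 : (0 : ℝ) < n := by linarith
  have hnθ : 1 ≤ (n : ℝ) ^ θ := Real.one_le_rpow hn1 hθ.le
  have hstep : ∑' z, connProb μ E n x (x - z) ≤ _ :=
    tsum_le_of_le_rpow (f := fun z => connProb μ E n x (x - z)) (a := connCoeff C s K θ n)
    (s := s) (t := t) (by unfold connCoeff; positivity) ht ht1 (fun z => connProb_le_one _ _ _)
    fun z hz => by
      have := hE.connProb_le_of_tsum_le hC hs hK hθ hθ1 hq ih (x := x) (y := x - z)
        (by rw [Ne, eq_comm, sub_eq_self]; exact hz)
      simpa using this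
  have hshift : ∑' y, connProb μ E n x y = ∑' z, connProb μ E n x (x - z) :=
    (tsum_sub_site (fun y => connProb μ E n x y) x).symm
  rw [hshift]
  refine hstep.trans ?_
  rw [hS, ← ENNReal.ofReal_one, ← ENNReal.ofReal_mul (by unfold connCoeff; positivity),
    ← ENNReal.ofReal_add zero_le_one (by unfold connCoeff; positivity)]
  refine ENNReal.ofReal_le_ofReal ?_
  have hcoeff : connCoeff C s K θ n ^ t
      = (C * 2 ^ s) ^ t * ((n : ℝ) ^ ((1 + s) * t) * Real.exp (K * β * (n : ℝ) ^ θ)) := by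
    unfold connCoeff
    rw [mul_assoc, Real.mul_rpow (x := C * 2 ^ s) (by positivity) (by positivity),
      Real.mul_rpow (x := (n : ℝ) ^ (1 + s)) (by positivity) (by positivity),
      ← Real.rpow_mul hn0.le, ← Real.exp_mul]
    congr 3
    ring
  have hpow : (n : ℝ) ^ ((1 + s) * t) ≤ Real.exp ((1 + s) * t / θ * (n : ℝ) ^ θ) := by
    rw [Real.rpow_def_of_pos hn0]
    refine Real.exp_le_exp.2 ?_
    calc Real.log n * ((1 + s) * t) ≤ ((n : ℝ) ^ θ / θ) * ((1 + s) * t) := by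
          gcongr
          exact Real.log_le_rpow_div hn0.le hθ
      _ = _ := by ring
  have hBexp : B ≤ Real.exp (Real.log B * (n : ℝ) ^ θ) := by
    nth_rewrite 1 [← Real.exp_log (zero_lt_one.trans_le hB)]
    exact Real.exp_le_exp.2 (le_mul_of_one_le_right (Real.log_nonneg hB) hnθ)
  -- Allows the additive 1 to be absorbed into the constant `B`.
  have hge : 1 ≤ (n : ℝ) ^ ((1 + s) * t) * Real.exp (K * β * (n : ℝ) ^ θ) :=
    one_le_mul_of_one_le_of_one_le (Real.one_le_rpow hn1 (by positivity))
      (Real.one_le_exp (by positivity))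
  calc 1 + connCoeff C s K θ n ^ t * S
      ≤ B * ((n : ℝ) ^ ((1 + s) * t) * Real.exp (K * β * (n : ℝ) ^ θ)) := by
        rw [hcoeff]
        simp only [B]
        nlinarith
    _ ≤ Real.exp (Real.log B * (n : ℝ) ^ θ) * (Real.exp ((1 + s) * t / θ * (n : ℝ) ^ θ)
          * Real.exp (K * β * (n : ℝ) ^ θ)) := by gcongr
    _ = Real.exp (K * (n : ℝ) ^ θ) := by
        rw [← Real.exp_add, ← Real.exp_add]
        congr 1
        calc _ = (Real.log B + (1 + s) * t / θ + K * β) * (n : ℝ) ^ θ := by ring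
          _ = _ := by rw [hKeq]

theorem one_div_Delta {s : ℝ} : 1 / Delta d s = Real.logb 2 (2 * d / s) := by
  rw [Delta, one_div_div, Real.logb]

theorem tendsto_log_add_rpow_sub_rpow {a b c θ θ' : ℝ} (hθ : 0 < θ') (h : θ < θ') (hc : 0 < c) :
    Tendsto (fun r : ℝ => a * Real.log r + b * r ^ θ - c * r ^ θ') atTop atBot := by
  have h1 : Tendsto (fun r : ℝ => Real.log r / r ^ θ') atTop (𝓝 0) :=
    (isLittleO_log_rpow_atTop hθ).tendsto_div_nhds_zero
  have h2 : Tendsto (fun r : ℝ => r ^ (-(θ' - θ))) atTop (𝓝 0) :=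
    tendsto_rpow_neg_atTop (sub_pos.2 h)
  have h3 : Tendsto (fun r : ℝ => a * (Real.log r / r ^ θ') + b * r ^ (-(θ' - θ)) - c) atTop
      (𝓝 (a * 0 + b * 0 - c)) := ((h1.const_mul a).add (h2.const_mul b)).sub_const c
  have h4 := (tendsto_rpow_atTop hθ).atTop_mul_neg (by linarith) h3
  refine h4.congr' ?_
  filter_upwards [eventually_gt_atTop 0] with r hr
  have hr' : 0 < r ^ θ' := Real.rpow_pos_of_pos hr _
  rw [neg_sub, Real.rpow_sub hr]
  field_simp

theorem not_mem_box {x : Site d} {L : ℝ} (hL : 0 ≤ L) : x ∉ box d L ↔ L < ‖x‖ := by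
  rw [← not_le, not_iff_not, pi_norm_le_iff_of_nonneg hL]
  simp only [Int.norm_eq_abs]
  rfl

theorem mem_intrinsicBall {E : Set (Sym2 (Site d))} {r : ℝ} (hr : 0 ≤ r) {x : Site d} :
    x ∈ intrinsicBall E r ↔ (percGraph E).edist 0 x ≤ (⌊r⌋₊ : ℕ) := by
  change (((percGraph E).edist 0 x : ℝ≥0∞) : EReal) ≤ (r : EReal) ↔ _
  induction (percGraph E).edist 0 x with
  | top => simp
  | coe n =>
    have h : ((((n : ℕ∞) : ℝ≥0∞)) : EReal) = ((n : ℝ) : EReal) := by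
      simp only [ENat.toENNReal_coe]
      rfl
    rw [h, EReal.coe_le_coe_iff, Nat.cast_le, Nat.le_floor_iff hr]

/-- The intrinsic ball is contained in the box of side `exp (r ^ θ)` for `θ > 1 / Δ`. -/
theorem IsLongRangePercolation.tendsto_measure_not_subset_box [IsProbabilityMeasure μ]
    (hE : IsLongRangePercolation q μ E) {s θ : ℝ} (hs : s ∈ Set.Ioo (d : ℝ) (2 * d))
    (hlim : HasDecayExponent q s) (hθ : 1 / Delta d s < θ) :
    Tendsto (fun r : ℝ => μ {ω | ¬ intrinsicBall (E ω) r ⊆ box d (Real.exp (r ^ θ))})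
      atTop (𝓝 0) := by
  obtain ⟨hs1, hs2⟩ := hs
  have hd0 : (0 : ℝ) < d := by linarith
  have hs0 : 0 < s := by linarith
  rw [one_div_Delta] at hθ
  have hw0 : 0 < Real.logb 2 (2 * d / s) :=
    Real.logb_pos one_lt_two (by rwa [one_lt_div hs0])
  have hw1 : Real.logb 2 (2 * d / s) < 1 := by
    rw [Real.logb_lt_iff_lt_rpow one_lt_two (by positivity), Real.rpow_one, div_lt_iff₀ hs0]
    linarith
  -- Order of choices: `θ₀` between `1 / Δ` and `min θ 1`, then `t > d / s` with `t * 2 ^ (1 - θ₀) <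
  -- 1`, then a decay exponent `s₁ < s` with `d < s₁ * t`, and finally `s₂` between `d` and `s₁`.
  obtain ⟨θ₀, hwθ, hθ₀⟩ := exists_between (lt_min hθ hw1)
  have hθ₀1 : θ₀ < 1 := hθ₀.trans_le (min_le_right _ _)
  have hθ₀' : θ₀ < θ := hθ₀.trans_le (min_le_left _ _)
  have hθ₀0 : 0 < θ₀ := hw0.trans hwθ
  have hpow : d / s * 2 ^ (1 - θ₀) < 1 := by
    rw [Real.logb_lt_iff_lt_rpow one_lt_two (by positivity)] at hwθ
    rw [Real.rpow_sub two_pos, Real.rpow_one, div_mul_div_comm, div_lt_one (by positivity)]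
    rw [div_lt_iff₀ hs0] at hwθ
    linarith
  have hp2 : (0 : ℝ) < 2 ^ (1 - θ₀) := by positivity
  obtain ⟨t, htl, htu⟩ := exists_between
    (lt_min ((lt_div_iff₀ hp2).2 hpow) ((div_lt_one hs0).2 hs1))
  have ht1 : t < 1 := htu.trans_le (min_le_right _ _)
  have htβ : t * 2 ^ (1 - θ₀) < 1 := (lt_div_iff₀ hp2).1 (htu.trans_le (min_le_left _ _))
  have ht0 : 0 < t := (div_pos hd0 hs0).trans htl
  have hdt : d / t < s := by rwa [div_lt_comm₀ ht0 hs0]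
  obtain ⟨s₁, hs₁l, hs₁u⟩ := exists_between hdt
  have hst : (d : ℝ) < s₁ * t := (div_lt_iff₀ ht0).1 hs₁l
  have hs₁d : (d : ℝ) < s₁ := by
    refine lt_of_le_of_lt ?_ hs₁l
    rw [le_div_iff₀ ht0]
    nlinarith
  have hs₁0 : 0 ≤ s₁ := by linarith
  obtain ⟨C, hC, hq⟩ := hlim.exists_edgeProb_le hs₁u hs₁0
  obtain ⟨K, hK, hM⟩ := hE.exists_tsum_connProb_le hC hs₁0 hθ₀0 hθ₀1.le ht0 ht1.le hst htβ hq
  obtain ⟨s₂, hs₂l, hs₂u⟩ := exists_between hs₁d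
  set S := (∑' z : Site d, ENNReal.ofReal (‖z‖ ^ (-s₂))).toReal
  have hS : ∑' z : Site d, ENNReal.ofReal (‖z‖ ^ (-s₂)) = ENNReal.ofReal S :=
    (ENNReal.ofReal_toReal (tsum_ofReal_norm_rpow_ne_top hs₂l)).symm
  have hbound : ∀ r : ℝ, 1 ≤ r →
      μ {ω | ¬ intrinsicBall (E ω) r ⊆ box d (Real.exp (r ^ θ))}
        ≤ ENNReal.ofReal (connCoeff C s₁ K θ₀ r * Real.exp (r ^ θ) ^ (-(s₁ - s₂)))
          * ENNReal.ofReal S := by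
    intro r hr
    have hr0 : 0 ≤ r := by linarith
    set n := ⌊r⌋₊
    have hnr : (n : ℝ) ≤ r := Nat.floor_le hr0
    have hsub : {ω | ¬ intrinsicBall (E ω) r ⊆ box d (Real.exp (r ^ θ))} ⊆
        ⋃ x : Site d, {ω | Real.exp (r ^ θ) < ‖x‖ ∧ Conn n 0 x (conf (edgeEvent E) ω)} := by
      intro ω hω
      obtain ⟨x, hx, hx'⟩ := Set.not_subset.1 hω
      rw [not_mem_box (Real.exp_pos _).le] at hx'
      rw [mem_intrinsicBall hr0, ← conn_edgeSet_iff] at hx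
      exact Set.mem_iUnion.2 ⟨x, hx', hx⟩
    refine (measure_mono hsub).trans ((measure_iUnion_le _).trans ?_)
    rw [← hS, ← ENNReal.tsum_mul_left]
    refine ENNReal.tsum_le_tsum fun x => ?_
    by_cases hx : Real.exp (r ^ θ) < ‖x‖
    · simp only [hx, true_and]
      have hxpos : 0 < ‖x‖ := (Real.exp_pos _).trans hx
      have hx0 : (0 : Site d) ≠ x := (norm_pos_iff.1 hxpos).symm
      refine (hE.connProb_le_of_tsum_le hC hs₁0 hK hθ₀0 hθ₀1.le hq (fun k _ => hM k) hx0).trans ?_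
      rw [← ENNReal.ofReal_mul (by unfold connCoeff; positivity)]
      refine ENNReal.ofReal_le_ofReal ?_
      -- The second factor is summable. The first is at most `exp (-(s₁ - s₂) r ^ θ)` outside the
      -- box and beats the growth `exp (O(r ^ θ₀))` of the coefficient.
      have h1 : ‖x‖ ^ (-s₁) = ‖x‖ ^ (-(s₁ - s₂)) * ‖x‖ ^ (-s₂) := by
        rw [← Real.rpow_add hxpos]; congr 1; ring
      rw [zero_sub, norm_neg, h1, ← mul_assoc]
      refine mul_le_mul_of_nonneg_right ?_ (by positivity)
      have h2 : ‖x‖ ^ (-(s₁ - s₂)) ≤ Real.exp (r ^ θ) ^ (-(s₁ - s₂)) :=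
        Real.rpow_le_rpow_of_nonpos (Real.exp_pos _) hx.le (by linarith)
      have h3 : connCoeff C s₁ K θ₀ n ≤ connCoeff C s₁ K θ₀ r := by
        unfold connCoeff
        gcongr
      refine mul_le_mul h3 h2 (by positivity) (by unfold connCoeff; positivity)
    · simp [hx]
  have hexp : ∀ r : ℝ, 0 < r → connCoeff C s₁ K θ₀ r * Real.exp (r ^ θ) ^ (-(s₁ - s₂))
      = C * 2 ^ s₁ * Real.exp ((1 + s₁) * Real.log r + (K * 2 ^ (1 - θ₀)) * r ^ θ₀
          - (s₁ - s₂) * r ^ θ) := by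
    intro r hr
    rw [connCoeff, Real.rpow_def_of_pos hr (1 + s₁), ← Real.exp_mul, mul_assoc, mul_assoc,
      ← Real.exp_add, ← Real.exp_add]
    ring_nf
  have hlim0 : Tendsto (fun r : ℝ => ENNReal.ofReal
      (connCoeff C s₁ K θ₀ r * Real.exp (r ^ θ) ^ (-(s₁ - s₂))) * ENNReal.ofReal S)
      atTop (𝓝 0) := by
    have h1 : Tendsto (fun r : ℝ => C * 2 ^ s₁ * Real.exp ((1 + s₁) * Real.log r
        + (K * 2 ^ (1 - θ₀)) * r ^ θ₀ - (s₁ - s₂) * r ^ θ)) atTop (𝓝 (C * 2 ^ s₁ * 0)) :=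
      (Real.tendsto_exp_atBot.comp (tendsto_log_add_rpow_sub_rpow (hθ₀0.trans hθ₀') hθ₀'
        (sub_pos.2 hs₂u))).const_mul _
    have h2 := ENNReal.Tendsto.mul_const (b := ENNReal.ofReal S) (ENNReal.tendsto_ofReal h1)
      (Or.inr ENNReal.ofReal_ne_top)
    rw [mul_zero, ENNReal.ofReal_zero, zero_mul] at h2
    refine h2.congr' ?_
    filter_upwards [eventually_gt_atTop 0] with r hr
    rw [hexp r hr]
  refine tendsto_of_tendsto_of_tendsto_of_le_of_le' tendsto_const_nhds hlim0
    (Eventually.of_forall fun _ => zero_le) ?_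
  filter_upwards [eventually_ge_atTop 1] with r hr using hbound r hr

end Growth

/-! ### Graph distance truncated at a fixed level. -/

section TruncatedDistance

variable {V : Type*}

/-- The graph distance in the graph with edge set `S`, truncated at `T`. -/
def truncDist (T : ℕ) (S : Set (Sym2 V)) (x y : V) : ℕ :=
  (min ((SimpleGraph.fromEdgeSet S).edist x y) T).toNat

theorem coe_truncDist (T : ℕ) (S : Set (Sym2 V)) (x y : V) :
    (truncDist T S x y : ℕ∞) = min ((SimpleGraph.fromEdgeSet S).edist x y) T :=
  ENat.natCast_toNat (ne_top_of_le_ne_top (ENat.natCast_ne_top T) (min_le_right _ _))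

theorem truncDist_le (T : ℕ) (S : Set (Sym2 V)) (x y : V) : truncDist T S x y ≤ T := by
  have h := coe_truncDist T S x y
  have h2 : (truncDist T S x y : ℕ∞) ≤ T := h.trans_le (min_le_right _ _)
  exact_mod_cast h2

theorem truncDist_anti {T : ℕ} {S S' : Set (Sym2 V)} (h : S ⊆ S') (x y : V) :
    truncDist T S' x y ≤ truncDist T S x y := by
  have h2 : (truncDist T S' x y : ℕ∞) ≤ truncDist T S x y := by
    rw [coe_truncDist, coe_truncDist]
    exact min_le_min_right _ (SimpleGraph.edist_anti (SimpleGraph.fromEdgeSet_mono h))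
  exact_mod_cast h2

theorem truncDist_le_of_conn {T n : ℕ} {S : Set (Sym2 V)} {x y : V} (h : Conn n x y S) :
    truncDist T S x y ≤ n := by
  obtain ⟨p, hp⟩ := h
  have h2 : (truncDist T S x y : ℕ∞) ≤ n := by
    rw [coe_truncDist]
    exact (min_le_left _ _).trans (p.edist_le.trans (by exact_mod_cast hp))
  exact_mod_cast h2

theorem conn_of_truncDist_lt {T : ℕ} {S : Set (Sym2 V)} {x y : V} (h : truncDist T S x y < T) :
    Conn (truncDist T S x y) x y S := by
  have h1 := coe_truncDist T S x y
  have h2 : (SimpleGraph.fromEdgeSet S).edist x y = truncDist T S x y := by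
    rcases min_choice ((SimpleGraph.fromEdgeSet S).edist x y) (T : ℕ∞) with h3 | h3
    · rw [h1, h3]
    · rw [h3] at h1
      exact absurd (by exact_mod_cast h1) h.ne
  obtain ⟨p, hp⟩ := (SimpleGraph.reachable_of_edist_ne_top
    (h2.trans_ne (ENat.natCast_ne_top _))).exists_walk_length_eq_edist
  rw [h2] at hp
  exact ⟨p, le_of_eq (by exact_mod_cast hp)⟩

/-- Truncation preserves the triangle inequality: if a distance on the right equals `T`, nothing is
to be shown. -/
theorem truncDist_le_add {T : ℕ} {S : Set (Sym2 V)} {x u v y : V} (h : s(u, v) ∈ S) :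
    truncDist T S x y ≤ truncDist T S x u + 1 + truncDist T S v y := by
  by_cases h1 : truncDist T S x u < T
  · by_cases h2 : truncDist T S v y < T
    · obtain ⟨p, hp⟩ := conn_of_truncDist_lt h1
      obtain ⟨p', hp'⟩ := conn_of_truncDist_lt h2
      by_cases huv : u = v
      · subst huv
        refine truncDist_le_of_conn ⟨p.append p', ?_⟩
        rw [SimpleGraph.Walk.length_append]
        omega
      · have hadj : (SimpleGraph.fromEdgeSet S).Adj u v :=
          (SimpleGraph.fromEdgeSet_adj S).2 ⟨h, huv⟩
        refine truncDist_le_of_conn ⟨p.append (SimpleGraph.Walk.cons hadj p'), ?_⟩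
        rw [SimpleGraph.Walk.length_append, SimpleGraph.Walk.length_cons]
        omega
    · have := truncDist_le T S x y
      omega
  · have := truncDist_le T S x y
    omega

end TruncatedDistance

/-! ### Pairs inside a block and pairs between two blocks. -/

section EdgeSets

variable {V : Type*}

/-- The pairs with both endpoints in `B`. -/
def inner (B : Set V) : Set (Sym2 V) := {e | ∀ v ∈ e, v ∈ B}

/-- The pairs with one endpoint in `B` and the other in `B'`. -/
def cross (B B' : Set V) : Set (Sym2 V) := (fun p : V × V => s(p.1, p.2)) '' (B ×ˢ B')

theorem mk_mem_inner {B : Set V} {u v : V} : s(u, v) ∈ inner B ↔ u ∈ B ∧ v ∈ B := by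
  simp [inner]

theorem mk_mem_cross {B B' : Set V} {u v : V} (hu : u ∈ B) (hv : v ∈ B') :
    s(u, v) ∈ cross B B' := ⟨(u, v), ⟨hu, hv⟩, rfl⟩

theorem inner_mono {B B' : Set V} (h : B ⊆ B') : inner B ⊆ inner B' :=
  fun _ he v hv => h (he v hv)

theorem cross_subset_inner {B₁ B₂ B : Set V} (h₁ : B₁ ⊆ B) (h₂ : B₂ ⊆ B) :
    cross B₁ B₂ ⊆ inner B := by
  rintro _ ⟨⟨u, v⟩, ⟨hu, hv⟩, rfl⟩
  exact mk_mem_inner.2 ⟨h₁ hu, h₂ hv⟩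

theorem finite_cross {B B' : Set V} (h : B.Finite) (h' : B'.Finite) : (cross B B').Finite :=
  (h.prod h').image _

theorem finite_inner {B : Set V} (h : B.Finite) : (inner B).Finite := by
  refine (finite_cross h h).subset fun e he => ?_
  induction e with
  | _ u v =>
    rw [mk_mem_inner] at he
    exact mk_mem_cross he.1 he.2

theorem disjoint_inner {B B' : Set V} (h : Disjoint B B') : Disjoint (inner B) (inner B') := by
  refine Set.disjoint_left.2 fun e he he' => ?_
  induction e with
  | _ u v => exact Set.disjoint_left.1 h (mk_mem_inner.1 he).1 (mk_mem_inner.1 he').1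

theorem disjoint_inner_cross {B B' : Set V} (h : Disjoint B B') :
    Disjoint (inner B) (cross B B') := by
  refine Set.disjoint_left.2 ?_
  rintro _ he ⟨⟨u, v⟩, ⟨hu, hv⟩, rfl⟩
  exact Set.disjoint_left.1 h (mk_mem_inner.1 he).2 hv

theorem disjoint_cross_inner {B B' : Set V} (h : Disjoint B B') :
    Disjoint (cross B B') (inner B') := by
  refine Set.disjoint_left.2 ?_
  rintro _ ⟨⟨u, v⟩, ⟨hu, hv⟩, rfl⟩ he
  exact Set.disjoint_left.1 h hu (mk_mem_inner.1 he).1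

open Classical in
/-- A pair in `B × B'` that is joined by an edge of `R`, if there is one. -/
def selectEdge (B B' : Set V) (R : Set (Sym2 V)) : Option (V × V) :=
  if h : ∃ p : V × V, p.1 ∈ B ∧ p.2 ∈ B' ∧ s(p.1, p.2) ∈ R then some h.choose else none

theorem selectEdge_eq_some {B B' : Set V} {R : Set (Sym2 V)} {p : V × V}
    (h : selectEdge B B' R = some p) : p.1 ∈ B ∧ p.2 ∈ B' ∧ s(p.1, p.2) ∈ R := by
  unfold selectEdge at h
  split_ifs at h with h'
  rw [← Option.some.inj h]
  exact h'.choose_spec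

theorem selectEdge_eq_none {B B' : Set V} {R : Set (Sym2 V)} (h : selectEdge B B' R = none)
    {u v : V} (hu : u ∈ B) (hv : v ∈ B') : s(u, v) ∉ R := by
  unfold selectEdge at h
  split_ifs at h with h'
  exact fun hR => h' ⟨(u, v), hu, hv, hR⟩

end EdgeSets

/-! ### Exponential moments of distances inside a block. -/

section ExpMoment

variable {V Ω : Type*} [MeasurableSpace Ω] {μ : Measure Ω} {A : Sym2 V → Set Ω}

/-- The exponential moment of the truncated distance of `x` and `y` inside `B`. -/
def expMoment (μ : Measure Ω) (A : Sym2 V → Set Ω) (l : ℝ) (T : ℕ) (B : Set V) (x y : V) : ℝ≥0∞ :=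
  ∫⁻ ω, ENNReal.ofReal (Real.exp (l * truncDist T (conf A ω ∩ inner B) x y)) ∂μ

theorem expMoment_anti {l : ℝ} (hl : 0 ≤ l) {T : ℕ} {B B' : Set V} (h : B ⊆ B') (x y : V) :
    expMoment μ A l T B' x y ≤ expMoment μ A l T B x y := by
  refine lintegral_mono fun ω => ENNReal.ofReal_le_ofReal (Real.exp_le_exp.2 ?_)
  refine mul_le_mul_of_nonneg_left ?_ hl
  exact_mod_cast truncDist_anti (Set.inter_subset_inter_right _ (inner_mono h)) x y

theorem expMoment_le_of_forall [IsProbabilityMeasure μ] {l : ℝ} (hl : 0 ≤ l) {T : ℕ} {B : Set V}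
    {x y : V} {N : ℝ} (h : ∀ ω, (truncDist T (conf A ω ∩ inner B) x y : ℝ) ≤ N) :
    expMoment μ A l T B x y ≤ ENNReal.ofReal (Real.exp (l * N)) := by
  refine (lintegral_mono (g := fun _ => ENNReal.ofReal (Real.exp (l * N))) fun ω =>
    ENNReal.ofReal_le_ofReal (Real.exp_le_exp.2
      (mul_le_mul_of_nonneg_left (h ω) hl))).trans_eq ?_
  simp

/-- Splitting a path at an edge between two disjoint sub-blocks. -/
theorem expMoment_le [IsProbabilityMeasure μ] (hA : ∀ e, MeasurableSet (A e))
    (hind : iIndepSet A μ) {l : ℝ} (hl : 0 ≤ l) {T : ℕ} {B B₁ B₂ : Set V} (hf₁ : B₁.Finite)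
    (hf₂ : B₂.Finite) (h₁ : B₁ ⊆ B) (h₂ : B₂ ⊆ B) (hd : Disjoint B₁ B₂) {x y : V} {N : ℝ}
    {H : ℝ≥0∞} (hN : ∀ ω, (truncDist T (conf A ω ∩ inner B) x y : ℝ) ≤ N)
    (hH₁ : ∀ u ∈ B₁, expMoment μ A l T B₁ x u ≤ H)
    (hH₂ : ∀ v ∈ B₂, expMoment μ A l T B₂ v y ≤ H) :
    expMoment μ A l T B x y ≤ ENNReal.ofReal (Real.exp l) * (H * H) +
      ENNReal.ofReal (Real.exp (l * N)) * μ (⋂ e ∈ cross B₁ B₂, (A e)ᶜ) := by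
  classical
  let J : Finset (V × V) := hf₁.toFinset ×ˢ hf₂.toFinset
  let Y : V → Set (Sym2 V) → ℝ≥0∞ := fun u S =>
    ENNReal.ofReal (Real.exp (l * truncDist T S x u))
  let Z : V → Set (Sym2 V) → ℝ≥0∞ := fun v S =>
    ENNReal.ofReal (Real.exp (l * truncDist T S v y))
  let I : V × V → Set (Sym2 V) → ℝ≥0∞ := fun p S =>
    if selectEdge B₁ B₂ S = some p then 1 else 0
  have hfc := finite_cross hf₁ hf₂
  have hmeas : ∀ {F : Set (Sym2 V)} (_ : F.Finite) (f : Set (Sym2 V) → ℝ≥0∞),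
      Measurable fun ω => f (conf A ω ∩ F) := fun hF f =>
    (measurable_confSigma A hF f).mono (confSigma_le hA _) le_rfl
  -- Either one crossing edge is selected and the path is routed through it, or no crossing edge
  -- exists and the worst-case bound `N` is used.
  have hpt : ∀ ω, ENNReal.ofReal (Real.exp (l * truncDist T (conf A ω ∩ inner B) x y)) ≤
      (∑ p ∈ J, ENNReal.ofReal (Real.exp l) * (Y p.1 (conf A ω ∩ inner B₁) *
        (I p (conf A ω ∩ cross B₁ B₂) * Z p.2 (conf A ω ∩ inner B₂)))) +
      (⋂ e ∈ cross B₁ B₂, (A e)ᶜ).indicator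
        (fun _ => ENNReal.ofReal (Real.exp (l * N))) ω := by
    intro ω
    cases hsel : selectEdge B₁ B₂ (conf A ω ∩ cross B₁ B₂) with
    | none =>
      refine le_add_left ?_
      rw [Set.indicator_of_mem]
      · exact ENNReal.ofReal_le_ofReal (Real.exp_le_exp.2 (mul_le_mul_of_nonneg_left (hN ω) hl))
      · simp only [Set.mem_iInter]
        rintro _ ⟨⟨u, v⟩, ⟨hu, hv⟩, rfl⟩ hmem
        exact selectEdge_eq_none hsel hu hv ⟨hmem, mk_mem_cross hu hv⟩
    | some p =>
      obtain ⟨hp1, hp2, hp3⟩ := selectEdge_eq_some hsel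
      have hpJ : p ∈ J := by simp [J, hp1, hp2]
      refine le_add_right (le_trans ?_ (Finset.single_le_sum (fun _ _ => zero_le) hpJ))
      simp only [I, hsel, if_true, one_mul, Y, Z]
      rw [← ENNReal.ofReal_mul (Real.exp_pos _).le, ← Real.exp_add,
        ← ENNReal.ofReal_mul (Real.exp_pos _).le, ← Real.exp_add]
      refine ENNReal.ofReal_le_ofReal (Real.exp_le_exp.2 ?_)
      have htri := truncDist_le_add (T := T) (x := x) (y := y)
        (show s(p.1, p.2) ∈ conf A ω ∩ inner B from
          ⟨hp3.1, cross_subset_inner h₁ h₂ hp3.2⟩)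
      have ha1 := truncDist_anti (T := T)
        (Set.inter_subset_inter_right (conf A ω) (inner_mono h₁)) x p.1
      have ha2 := truncDist_anti (T := T)
        (Set.inter_subset_inter_right (conf A ω) (inner_mono h₂)) p.2 y
      have hnat : truncDist T (conf A ω ∩ inner B) x y ≤
          1 + (truncDist T (conf A ω ∩ inner B₁) x p.1
            + truncDist T (conf A ω ∩ inner B₂) p.2 y) := by omega
      have hreal : (truncDist T (conf A ω ∩ inner B) x y : ℝ) ≤
          1 + (truncDist T (conf A ω ∩ inner B₁) x p.1
            + truncDist T (conf A ω ∩ inner B₂) p.2 y) := by exact_mod_cast hnat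
      have := mul_le_mul_of_nonneg_left hreal hl
      linarith
  have hterm : ∀ p ∈ J, ∫⁻ ω, ENNReal.ofReal (Real.exp l) * (Y p.1 (conf A ω ∩ inner B₁) *
        (I p (conf A ω ∩ cross B₁ B₂) * Z p.2 (conf A ω ∩ inner B₂))) ∂μ
      ≤ ENNReal.ofReal (Real.exp l) * (H * H) * ∫⁻ ω, I p (conf A ω ∩ cross B₁ B₂) ∂μ := by
    intro p hp
    simp only [J, Finset.mem_product, Set.Finite.mem_toFinset] at hp
    rw [lintegral_const_mul' _ _ ENNReal.ofReal_ne_top]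
    -- The selection looks only at crossing pairs, so it is independent of the distances inside both
    -- sub-blocks.
    have e1 : ∫⁻ ω, Y p.1 (conf A ω ∩ inner B₁) *
        (I p (conf A ω ∩ cross B₁ B₂) * Z p.2 (conf A ω ∩ inner B₂)) ∂μ
        = (∫⁻ ω, Y p.1 (conf A ω ∩ inner B₁) ∂μ) *
          ∫⁻ ω, I p (conf A ω ∩ cross B₁ B₂) * Z p.2 (conf A ω ∩ inner B₂) ∂μ := by
      have h := lintegral_mul_conf hA hind (finite_inner hf₁) (hfc.union (finite_inner hf₂))
        (Disjoint.union_right (disjoint_inner_cross hd) (disjoint_inner hd)) (Y p.1)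
        (fun S => I p (S ∩ cross B₁ B₂) * Z p.2 (S ∩ inner B₂))
      have i1 : ∀ ω, conf A ω ∩ (cross B₁ B₂ ∪ inner B₂) ∩ cross B₁ B₂
          = conf A ω ∩ cross B₁ B₂ := fun ω => by
        rw [Set.inter_assoc, Set.union_inter_cancel_left]
      have i2 : ∀ ω, conf A ω ∩ (cross B₁ B₂ ∪ inner B₂) ∩ inner B₂
          = conf A ω ∩ inner B₂ := fun ω => by
        rw [Set.inter_assoc, Set.union_inter_cancel_right]
      simpa only [i1, i2] using h
    have e2 := lintegral_mul_conf hA hind hfc (finite_inner hf₂) (disjoint_cross_inner hd)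
      (I p) (Z p.2)
    rw [e1, e2]
    have b1 : ∫⁻ ω, Y p.1 (conf A ω ∩ inner B₁) ∂μ ≤ H := hH₁ _ hp.1
    have b2 : ∫⁻ ω, Z p.2 (conf A ω ∩ inner B₂) ∂μ ≤ H := hH₂ _ hp.2
    calc _ ≤ ENNReal.ofReal (Real.exp l) *
          (H * ((∫⁻ ω, I p (conf A ω ∩ cross B₁ B₂) ∂μ) * H)) := by gcongr
      _ = _ := by ring
  -- At most one pair is selected, so summing over `J` costs no factor for the number of pairs.
  have hsum : ∑ p ∈ J, ∫⁻ ω, I p (conf A ω ∩ cross B₁ B₂) ∂μ ≤ 1 := by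
    rw [← lintegral_finsetSum _ fun p _ => hmeas hfc (I p)]
    refine (lintegral_mono (g := fun _ => 1) fun ω => ?_).trans_eq (by simp)
    simp only [I]
    cases selectEdge B₁ B₂ (conf A ω ∩ cross B₁ B₂) with
    | none => simp
    | some p =>
      simp only [Option.some.injEq, Finset.sum_ite_eq]
      split_ifs <;> simp
  have hmI : MeasurableSet (⋂ e ∈ cross B₁ B₂, (A e)ᶜ) :=
    MeasurableSet.biInter hfc.countable fun e _ => (hA e).compl
  calc expMoment μ A l T B x y ≤ _ := lintegral_mono hpt
    _ = (∑ p ∈ J, ∫⁻ ω, ENNReal.ofReal (Real.exp l) * (Y p.1 (conf A ω ∩ inner B₁) *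
          (I p (conf A ω ∩ cross B₁ B₂) * Z p.2 (conf A ω ∩ inner B₂))) ∂μ)
        + ENNReal.ofReal (Real.exp (l * N)) * μ (⋂ e ∈ cross B₁ B₂, (A e)ᶜ) := by
        rw [lintegral_add_right _ (measurable_const.indicator hmI),
          lintegral_indicator_const hmI, lintegral_finsetSum]
        exact fun p _ => ((hmeas (finite_inner hf₁) (Y p.1)).mul
          ((hmeas hfc (I p)).mul (hmeas (finite_inner hf₂) (Z p.2)))).const_mul _
    _ ≤ _ := by
        gcongr
        refine (Finset.sum_le_sum hterm).trans ?_
        rw [← Finset.mul_sum]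
        exact mul_le_of_le_one_right' hsum

end ExpMoment

/-! ### Dyadic boxes and nearest-neighbour paths inside them. -/

section DyadicBoxes

variable {d : ℕ}

/-- The dyadic box of side `2 ^ m` that contains `x`, in the subdivision with corner `o`. -/
def dyadicBox (o : Site d) (m : ℕ) (x : Site d) : Finset (Site d) :=
  Fintype.piFinset fun i => Finset.Ico (o i + 2 ^ m * ((x i - o i) / 2 ^ m))
    (o i + 2 ^ m * ((x i - o i) / 2 ^ m) + 2 ^ m)

theorem mem_dyadicBox {o : Site d} {m : ℕ} {x y : Site d} :
    y ∈ dyadicBox o m x ↔ ∀ i, (y i - o i) / 2 ^ m = (x i - o i) / 2 ^ m := by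
  rw [dyadicBox, Fintype.mem_piFinset]
  refine forall_congr' fun i => ?_
  have h2 : (0 : ℤ) < 2 ^ m := by positivity
  rw [Finset.mem_Ico, Int.ediv_eq_iff_of_pos h2]
  constructor <;> rintro ⟨ha, hb⟩ <;> constructor <;> linarith

theorem self_mem_dyadicBox (o : Site d) (m : ℕ) (x : Site d) : x ∈ dyadicBox o m x :=
  mem_dyadicBox.2 fun _ => rfl

theorem dyadicBox_eq_of_mem {o : Site d} {m : ℕ} {x y : Site d} (h : y ∈ dyadicBox o m x) :
    dyadicBox o m y = dyadicBox o m x := by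
  ext z
  rw [mem_dyadicBox] at h
  simp only [mem_dyadicBox, h]

theorem dyadicBox_subset {m m' : ℕ} (h : m' ≤ m) (o x : Site d) :
    dyadicBox o m' x ⊆ dyadicBox o m x := by
  intro y hy
  rw [mem_dyadicBox] at hy ⊢
  intro i
  have h2 : (2 : ℤ) ^ m = 2 ^ m' * 2 ^ (m - m') := by rw [← pow_add]; congr 1; omega
  rw [h2, ← Int.ediv_ediv_of_nonneg (by positivity), ← Int.ediv_ediv_of_nonneg (by positivity),
    hy i]

theorem disjoint_dyadicBox {o : Site d} {m : ℕ} {x y : Site d} (h : y ∉ dyadicBox o m x) :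
    Disjoint (dyadicBox o m x) (dyadicBox o m y) := by
  rw [Finset.disjoint_left]
  intro z hz hz'
  apply h
  rw [← dyadicBox_eq_of_mem hz, dyadicBox_eq_of_mem hz']
  exact self_mem_dyadicBox o m y

theorem card_dyadicBox (o : Site d) (m : ℕ) (x : Site d) :
    (dyadicBox o m x).card = 2 ^ (d * m) := by
  rw [dyadicBox, Fintype.card_piFinset]
  simp only [Int.card_Ico, add_sub_cancel_left, Finset.prod_const, Finset.card_univ,
    Fintype.card_fin]
  rw [mul_comm d m, pow_mul]
  congr 1

theorem abs_sub_le_of_mem_dyadicBox {o : Site d} {m : ℕ} {x y z : Site d}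
    (hx : x ∈ dyadicBox o m z) (hy : y ∈ dyadicBox o m z) (i : Fin d) : |x i - y i| ≤ 2 ^ m := by
  simp only [dyadicBox, Fintype.mem_piFinset, Finset.mem_Ico] at hx hy
  have h1 := hx i
  have h2 := hy i
  rw [abs_le]
  constructor <;> linarith

theorem norm_sub_le_of_mem_dyadicBox {o : Site d} {m : ℕ} {x y z : Site d}
    (hx : x ∈ dyadicBox o m z) (hy : y ∈ dyadicBox o m z) : ‖x - y‖ ≤ 2 ^ m := by
  refine (pi_norm_le_iff_of_nonneg (by positivity)).2 fun i => ?_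
  rw [Pi.sub_apply, Int.norm_eq_abs]
  exact_mod_cast abs_sub_le_of_mem_dyadicBox hx hy i

/-- Two sites of a box are joined inside the box by a nearest-neighbour path. -/
theorem conn_of_mem_piFinset_Ico {a b : Site d} {S : Set (Sym2 (Site d))}
    (hS : ∀ x ∈ Fintype.piFinset fun i => Finset.Ico (a i) (b i),
      ∀ y ∈ Fintype.piFinset fun i => Finset.Ico (a i) (b i),
        (latticeGraph d).Adj x y → s(x, y) ∈ S)
    {n : ℕ} {x y : Site d} (hx : x ∈ Fintype.piFinset fun i => Finset.Ico (a i) (b i))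
    (hy : y ∈ Fintype.piFinset fun i => Finset.Ico (a i) (b i))
    (hn : ∑ i, (x i - y i).natAbs ≤ n) : Conn n x y S := by
  induction n generalizing x with
  | zero =>
    have hxy : x = y := by
      funext i
      have := (Finset.sum_eq_zero_iff.1 (Nat.le_zero.1 hn)) i (Finset.mem_univ i)
      omega
    subst hxy
    exact ⟨SimpleGraph.Walk.nil, le_rfl⟩
  | succ n ih =>
    by_cases hxy : x = y
    · subst hxy
      exact ⟨SimpleGraph.Walk.nil, Nat.zero_le _⟩
    obtain ⟨i, hi⟩ := Function.ne_iff.1 hxy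
    -- One unit step towards `y` in a coordinate where they differ: it stays in the box and lowers
    -- the ℓ¹ distance by one.
    set x' := Function.update x i (x i + (y i - x i).sign) with hx'def
    have hx'i : x' i = x i + (y i - x i).sign := Function.update_self ..
    have hx'j : ∀ j, j ≠ i → x' j = x j := fun j hj => Function.update_of_ne hj ..
    have hx' : x' ∈ Fintype.piFinset fun i => Finset.Ico (a i) (b i) := by
      rw [Fintype.mem_piFinset] at hx hy ⊢
      intro j
      by_cases hj : j = i
      · subst hj
        have h1 := Finset.mem_Ico.1 (hx j)
        have h2 := Finset.mem_Ico.1 (hy j)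
        rw [hx'i, Finset.mem_Ico]
        rcases lt_or_gt_of_ne hi with h | h
        · rw [Int.sign_eq_one_of_pos (by omega)]; omega
        · rw [Int.sign_eq_neg_one_of_neg (by omega)]; omega
      · rw [hx'j j hj]
        exact hx j
    have hadj : (latticeGraph d).Adj x x' := by
      change ∑ j, |x j - x' j| = 1
      rw [Finset.sum_eq_single i]
      · rw [hx'i]
        rcases lt_or_gt_of_ne hi with h | h
        · rw [Int.sign_eq_one_of_pos (by omega)]; simp
        · rw [Int.sign_eq_neg_one_of_neg (by omega)]; simp
      · intro j _ hj
        simp [hx'j j hj]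
      · simp
    have hsum : ∑ j, (x' j - y j).natAbs ≤ n := by
      rw [← Finset.add_sum_erase _ _ (Finset.mem_univ i)] at hn ⊢
      have h1 : ∑ j ∈ Finset.univ.erase i, (x' j - y j).natAbs
          = ∑ j ∈ Finset.univ.erase i, (x j - y j).natAbs :=
        Finset.sum_congr rfl fun j hj => by rw [hx'j j (Finset.ne_of_mem_erase hj)]
      have h2 : (x' i - y i).natAbs + 1 = (x i - y i).natAbs := by
        rw [hx'i]
        rcases lt_or_gt_of_ne hi with h | h
        · rw [Int.sign_eq_one_of_pos (by omega)]; omega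
        · rw [Int.sign_eq_neg_one_of_neg (by omega)]; omega
      omega
    obtain ⟨p, hp⟩ := ih hx' hsum
    have hadj' : (SimpleGraph.fromEdgeSet S).Adj x x' :=
      (SimpleGraph.fromEdgeSet_adj S).2 ⟨hS x hx x' hx' hadj, hadj.ne⟩
    exact ⟨SimpleGraph.Walk.cons hadj' p, by rw [SimpleGraph.Walk.length_cons]; omega⟩

theorem truncDist_dyadicBox_le {Ω : Type*} (E : Ω → Set (Sym2 (Site d))) (ω : Ω) (T : ℕ)
    {o : Site d} {m : ℕ} {x y z : Site d} (hx : x ∈ dyadicBox o m z) (hy : y ∈ dyadicBox o m z) :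
    truncDist T (conf (edgeEvent E) ω ∩ inner (dyadicBox o m z)) x y ≤ d * 2 ^ m := by
  refine truncDist_le_of_conn (conn_of_mem_piFinset_Ico ?_ hx hy ?_)
  · intro u hu v hv huv
    exact ⟨mem_edgeEvent.2 (Or.inl huv), mk_mem_inner.2 ⟨hu, hv⟩⟩
  · have h : ∀ i ∈ Finset.univ, (x i - y i).natAbs ≤ 2 ^ m := fun i _ => by
      have := abs_sub_le_of_mem_dyadicBox hx hy i
      rw [Int.abs_eq_natAbs] at this
      exact_mod_cast this
    simpa using Finset.sum_le_card_nsmul _ _ _ h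

end DyadicBoxes

/-! ### Connecting two sub-boxes by an edge, and the recursion over scales. -/

section BlockConnection

variable {d : ℕ} {Ω : Type*} [MeasurableSpace Ω] {q : Site d → ℝ≥0∞} {μ : Measure Ω}
  {E : Ω → Set (Sym2 (Site d))}

theorem card_filter_norm_sub_lt_le (B : Finset (Site d)) (R : ℝ) (u : Site d) :
    (B.filter fun v => ¬ R ≤ ‖u - v‖).card ≤ (2 * ⌈R⌉₊ + 1) ^ d := by
  have hsub : (B.filter fun v => ¬ R ≤ ‖u - v‖) ⊆
      Fintype.piFinset fun i => Finset.Icc (u i - ⌈R⌉₊) (u i + ⌈R⌉₊) := by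
    intro v hv
    rw [Finset.mem_filter, not_le] at hv
    rw [Fintype.mem_piFinset]
    intro i
    have h1 : ‖(u - v) i‖ ≤ ⌈R⌉₊ := (norm_le_pi_norm _ i).trans (hv.2.le.trans (Nat.le_ceil R))
    rw [Pi.sub_apply, Int.norm_eq_abs] at h1
    have h2 : |u i - v i| ≤ (⌈R⌉₊ : ℤ) := by exact_mod_cast h1
    rw [abs_le] at h2
    rw [Finset.mem_Icc]
    constructor <;> linarith
  refine (Finset.card_le_card hsub).trans_eq ?_
  rw [Fintype.card_piFinset]
  have hcard : ∀ i, (Finset.Icc (u i - ⌈R⌉₊) (u i + ⌈R⌉₊)).card = 2 * ⌈R⌉₊ + 1 := fun i => by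
    rw [Int.card_Icc]
    omega
  simp only [hcard, Finset.prod_const, Finset.card_univ, Fintype.card_fin]

/-- The lower bound on `q` holds only beyond `R`. Each site has boundedly many neighbours within
`R`, so in large blocks at least half of the pairs remain usable. -/
theorem card_far_pairs {R : ℝ} {k : ℕ} {B₁ B₂ : Finset (Site d)} (h₁ : B₁.card = k)
    (h₂ : B₂.card = k) (hR : (2 * ⌈R⌉₊ + 1) ^ d * 2 ≤ k) :
    (k : ℝ) ^ 2 / 2 ≤ (((B₁ ×ˢ B₂).filter fun p => R ≤ ‖p.1 - p.2‖).card : ℝ) := by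
  have hnear : ((B₁ ×ˢ B₂).filter fun p => ¬ R ≤ ‖p.1 - p.2‖).card
      ≤ k * (2 * ⌈R⌉₊ + 1) ^ d := by
    have : (B₁ ×ˢ B₂).filter (fun p => ¬ R ≤ ‖p.1 - p.2‖)
        ⊆ (B₁.sigma (fun u => B₂.filter fun v => ¬ R ≤ ‖u - v‖)).map
          (Equiv.sigmaEquivProd _ _).toEmbedding := by
      intro p hp
      simp only [Finset.mem_filter, Finset.mem_product] at hp
      simp only [Finset.mem_map, Finset.mem_sigma, Finset.mem_filter]
      exact ⟨⟨p.1, p.2⟩, ⟨hp.1.1, hp.1.2, hp.2⟩, rfl⟩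
    refine (Finset.card_le_card this).trans ?_
    rw [Finset.card_map, Finset.card_sigma, ← h₁, ← smul_eq_mul]
    exact Finset.sum_le_card_nsmul _ _ _ fun u _ => card_filter_norm_sub_lt_le _ _ _
  have hadd := Finset.card_filter_add_card_filter_not (s := B₁ ×ˢ B₂)
    (fun p => R ≤ ‖p.1 - p.2‖)
  rw [Finset.card_product, h₁, h₂] at hadd
  have h3 : k * (2 * ⌈R⌉₊ + 1) ^ d * 2 ≤ k * k := by
    rw [mul_assoc]
    exact Nat.mul_le_mul_left _ hR
  have h4 : k * k ≤ 2 * ((B₁ ×ˢ B₂).filter fun p => R ≤ ‖p.1 - p.2‖).card := by omega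
  have h5 : (k : ℝ) * k ≤ 2 * (((B₁ ×ˢ B₂).filter fun p => R ≤ ‖p.1 - p.2‖).card : ℝ) := by
    exact_mod_cast h4
  rw [sq]
  linarith

theorem IsLongRangePercolation.measure_compl_edgeEvent_le [IsProbabilityMeasure μ]
    (hE : IsLongRangePercolation q μ E) {x y : Site d} (h : x ≠ y) {κ : ℝ}
    (hκ : ENNReal.ofReal κ ≤ q (x - y)) :
    μ (edgeEvent E s(x, y))ᶜ ≤ ENNReal.ofReal (Real.exp (-κ)) := by
  rw [prob_compl_eq_one_sub (hE.measurableSet_edgeEvent _)]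
  calc 1 - μ (edgeEvent E s(x, y)) ≤ 1 - edgeProb (q (x - y)) :=
        tsub_le_tsub_left (hE.edgeProb_le h) _
    _ = EReal.exp (-(q (x - y) : EReal)) := one_sub_edgeProb _
    _ ≤ EReal.exp ((-κ : ℝ) : EReal) := by
        refine EReal.exp_le_exp_iff.2 ?_
        rw [EReal.coe_neg, EReal.neg_le_neg_iff]
        refine le_trans ?_ (EReal.coe_ennreal_le_coe_ennreal_iff.2 hκ)
        rw [EReal.coe_ennreal_ofReal]
        exact_mod_cast le_max_left κ 0
    _ = _ := EReal.exp_coe _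

/-- The probability that two disjoint finite blocks are not joined by an edge. -/
theorem IsLongRangePercolation.measure_no_cross_le [IsProbabilityMeasure μ]
    (hE : IsLongRangePercolation q μ E) {c s R D : ℝ} (hc : 0 ≤ c) (hs : 0 ≤ s)
    (hq : ∀ x : Site d, R ≤ ‖x‖ → ENNReal.ofReal (c * ‖x‖ ^ (-s)) ≤ q x) {k : ℕ}
    {B₁ B₂ : Finset (Site d)} (h₁ : B₁.card = k) (h₂ : B₂.card = k)
    (hR : (2 * ⌈R⌉₊ + 1) ^ d * 2 ≤ k) (hd : Disjoint B₁ B₂)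
    (hD : ∀ u ∈ B₁, ∀ v ∈ B₂, ‖u - v‖ ≤ D) :
    μ (⋂ e ∈ cross (B₁ : Set (Site d)) B₂, (edgeEvent E e)ᶜ)
      ≤ ENNReal.ofReal (Real.exp (-(c * D ^ (-s) * ((k : ℝ) ^ 2 / 2)))) := by
  classical
  set J := (B₁ ×ˢ B₂).filter fun p => R ≤ ‖p.1 - p.2‖
  let g : Site d × Site d → Sym2 (Site d) := fun p => s(p.1, p.2)
  have hmemJ : ∀ p ∈ J, p.1 ∈ B₁ ∧ p.2 ∈ B₂ ∧ R ≤ ‖p.1 - p.2‖ := fun p hp => by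
    simpa [J, and_assoc] using hp
  have hne : ∀ u ∈ B₁, ∀ v ∈ B₂, u ≠ v := fun u hu v hv huv =>
    Finset.disjoint_left.1 hd hu (huv ▸ hv)
  have hinj : Set.InjOn g J := by
    intro p hp p' hp' h
    obtain ⟨h1, h2, -⟩ := hmemJ p hp
    obtain ⟨h1', h2', -⟩ := hmemJ p' hp'
    rcases Sym2.eq_iff.1 h with ⟨ha, hb⟩ | ⟨ha, -⟩
    · exact Prod.ext ha hb
    · exact absurd ha (hne _ h1 _ h2')
  have hsub : (⋂ e ∈ cross (B₁ : Set (Site d)) B₂, (edgeEvent E e)ᶜ)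
      ⊆ ⋂ e ∈ J.image g, (edgeEvent E e)ᶜ := by
    refine Set.biInter_subset_biInter_left ?_
    intro e he
    obtain ⟨p, hp, rfl⟩ := Finset.mem_image.1 he
    obtain ⟨h1, h2, -⟩ := hmemJ p hp
    exact mk_mem_cross h1 h2
  have hprod : μ (⋂ e ∈ J.image g, (edgeEvent E e)ᶜ)
      = ∏ e ∈ J.image g, μ (edgeEvent E e)ᶜ :=
    ((iIndepSet_iff_iIndep _ _).1 hE.iIndepSet_edgeEvent).meas_biInter fun e _ =>
      (MeasurableSpace.measurableSet_generateFrom (Set.mem_singleton _)).compl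
  refine (measure_mono hsub).trans ?_
  rw [hprod, Finset.prod_image hinj]
  have hfac : ∀ p ∈ J, μ (edgeEvent E (g p))ᶜ ≤ ENNReal.ofReal (Real.exp (-(c * D ^ (-s)))) := by
    intro p hp
    obtain ⟨h1, h2, h3⟩ := hmemJ p hp
    have hpne := hne _ h1 _ h2
    refine hE.measure_compl_edgeEvent_le hpne (le_trans (ENNReal.ofReal_le_ofReal ?_) (hq _ h3))
    refine mul_le_mul_of_nonneg_left ?_ hc
    exact Real.rpow_le_rpow_of_nonpos (norm_pos_iff.2 (sub_ne_zero.2 hpne)) (hD _ h1 _ h2)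
      (by linarith)
  refine (Finset.prod_le_prod' hfac).trans ?_
  rw [Finset.prod_const, ← ENNReal.ofReal_pow (Real.exp_pos _).le, ← Real.exp_nat_mul]
  refine ENNReal.ofReal_le_ofReal (Real.exp_le_exp.2 ?_)
  have hJ := card_far_pairs h₁ h₂ hR
  rcases B₁.eq_empty_or_nonempty with rfl | ⟨u, hu⟩
  · have : k = 0 := by simpa using h₁.symm
    subst this
    simp [J]
  rcases B₂.eq_empty_or_nonempty with rfl | ⟨v, hv⟩
  · have : k = 0 := by simpa using h₂.symm
    subst this
    simp [J]
  have hD0 : 0 ≤ D := (norm_nonneg _).trans (hD u hu v hv)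
  have := mul_le_mul_of_nonneg_left hJ (show 0 ≤ c * D ^ (-s) by positivity)
  linarith

/-- A bound on the exponential moments of the truncated distances inside dyadic boxes. -/
def MomentBound (μ : Measure Ω) (E : Ω → Set (Sym2 (Site d))) (l : ℝ) (T : ℕ) (o : Site d)
    (m : ℕ) (b : ℝ) : Prop :=
  ∀ z, ∀ x ∈ dyadicBox o m z, ∀ y ∈ dyadicBox o m z,
    expMoment μ (edgeEvent E) l T (dyadicBox o m z) x y ≤ ENNReal.ofReal (Real.exp b)

theorem MomentBound.mono {l : ℝ} {T : ℕ} {o : Site d} {m : ℕ} {b b' : ℝ}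
    (h : MomentBound μ E l T o m b) (hb : b ≤ b') : MomentBound μ E l T o m b' :=
  fun z x hx y hy => (h z x hx y hy).trans (ENNReal.ofReal_le_ofReal (Real.exp_le_exp.2 hb))

theorem momentBound_trivial [IsProbabilityMeasure μ] {l : ℝ} (hl : 0 ≤ l) (T : ℕ) (o : Site d)
    (m : ℕ) : MomentBound μ E l T o m (l * (d * 2 ^ m)) := fun z x hx y hy =>
  expMoment_le_of_forall hl fun ω => by exact_mod_cast truncDist_dyadicBox_le E ω T hx hy

/-- An additive error `l` is absorbed into an extra factor `exp l`, because `1 + l ≤ exp l`. -/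
theorem exp_mul_add_le {l b : ℝ} (hl : 0 ≤ l) (hb : 0 ≤ b) :
    Real.exp l * (Real.exp b * Real.exp b) + l ≤ Real.exp (2 * b + 2 * l) := by
  have h1 : Real.exp (2 * b + 2 * l) = Real.exp l * Real.exp l * (Real.exp b * Real.exp b) := by
    rw [← Real.exp_add, ← Real.exp_add, ← Real.exp_add]
    congr 1
    ring
  rw [h1]
  have h2 := Real.add_one_le_exp l
  have h3 : 1 ≤ Real.exp b * Real.exp b :=
    one_le_mul_of_one_le_of_one_le (Real.one_le_exp hb) (Real.one_le_exp hb)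
  have h4 : 1 ≤ Real.exp l := Real.one_le_exp hl
  have h5 : l ≤ l * (Real.exp l * (Real.exp b * Real.exp b)) :=
    le_mul_of_one_le_right hl (one_le_mul_of_one_le_of_one_le h4 h3)
  have h6 : (l + 1) * (Real.exp l * (Real.exp b * Real.exp b))
      ≤ Real.exp l * (Real.exp l * (Real.exp b * Real.exp b)) := by gcongr
  linarith

/-- If `x` and `y` share a sub-box, its own bound suffices. Otherwise their sub-boxes are disjoint
and the path is split at an edge between them; `herr` keeps the contribution of a missing edge below
`l`. -/
theorem IsLongRangePercolation.momentBound_step [IsProbabilityMeasure μ]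
    (hE : IsLongRangePercolation q μ E) {c s R : ℝ} (hc : 0 ≤ c) (hs : 0 ≤ s)
    (hq : ∀ x : Site d, R ≤ ‖x‖ → ENNReal.ofReal (c * ‖x‖ ^ (-s)) ≤ q x) {l : ℝ} (hl : 0 ≤ l)
    {T : ℕ} {o : Site d} {m m' : ℕ} (hm : m' ≤ m) (hR : (2 * ⌈R⌉₊ + 1) ^ d * 2 ≤ 2 ^ (d * m'))
    (herr : Real.exp (l * min ((d : ℝ) * 2 ^ m) (T : ℝ)
      - c * ((2 : ℝ) ^ m) ^ (-s) * (((2 : ℝ) ^ (d * m')) ^ 2 / 2)) ≤ l)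
    {b : ℝ} (hb : 0 ≤ b) (h : MomentBound μ E l T o m' b) :
    MomentBound μ E l T o m (2 * b + 2 * l) := by
  intro z x hx y hy
  have hbox : ∀ w ∈ dyadicBox o m z, dyadicBox o m' w ⊆ dyadicBox o m z := fun w hw => by
    rw [← dyadicBox_eq_of_mem hw]
    exact dyadicBox_subset hm o w
  have h₁ := hbox x hx
  have h₂ := hbox y hy
  by_cases hxy : y ∈ dyadicBox o m' x
  · refine (expMoment_anti hl (Finset.coe_subset.2 h₁) x y).trans
      ((h x x (self_mem_dyadicBox o m' x) y hxy).trans ?_)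
    exact ENNReal.ofReal_le_ofReal (Real.exp_le_exp.2 (by linarith))
  have hd := disjoint_dyadicBox hxy
  have hmain := expMoment_le hE.measurableSet_edgeEvent hE.iIndepSet_edgeEvent hl (T := T)
    (Finset.finite_toSet _) (Finset.finite_toSet _) (Finset.coe_subset.2 h₁)
    (Finset.coe_subset.2 h₂) (Finset.disjoint_coe.2 hd) (x := x) (y := y)
    (N := min ((d : ℝ) * 2 ^ m) (T : ℝ)) (H := ENNReal.ofReal (Real.exp b))
    (fun ω => le_min (by exact_mod_cast truncDist_dyadicBox_le E ω T hx hy)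
      (by exact_mod_cast truncDist_le _ _ _ _))
    (fun u hu => h x x (self_mem_dyadicBox o m' x) u hu)
    (fun v hv => h y v hv y (self_mem_dyadicBox o m' y))
  have hcross := hE.measure_no_cross_le hc hs hq (card_dyadicBox o m' x) (card_dyadicBox o m' y)
    hR hd (D := 2 ^ m) fun u hu v hv => norm_sub_le_of_mem_dyadicBox (h₁ hu) (h₂ hv)
  refine hmain.trans ?_
  have herr' : ENNReal.ofReal (Real.exp (l * min ((d : ℝ) * 2 ^ m) (T : ℝ))) *
      μ (⋂ e ∈ cross (dyadicBox o m' x : Set (Site d)) (dyadicBox o m' y), (edgeEvent E e)ᶜ)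
      ≤ ENNReal.ofReal l := by
    refine (mul_le_mul_right hcross _).trans ?_
    rw [← ENNReal.ofReal_mul (Real.exp_pos _).le, ← Real.exp_add]
    refine ENNReal.ofReal_le_ofReal (le_trans (le_of_eq ?_) herr)
    push_cast
    rw [← sub_eq_add_neg]
  refine (add_le_add le_rfl herr').trans ?_
  rw [← ENNReal.ofReal_mul (Real.exp_pos _).le, ← ENNReal.ofReal_mul (Real.exp_pos _).le,
    ← ENNReal.ofReal_add (by positivity) hl]
  exact ENNReal.ofReal_le_ofReal (exp_mul_add_le hl hb)

theorem rpow_bound_of_recursion {P : ℕ → ℝ → Prop} (hP : ∀ m b b', P m b → b ≤ b' → P m b')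
    {γ γ' κ K l m₀ : ℝ} (hγ : 0 < γ) (hγ' : 0 < γ') (hγ'1 : γ' < 1) (hκ : 0 ≤ κ)
    (hγκ : 2 * γ' ^ κ ≤ 1) (hK : 0 ≤ K) (hl : 0 ≤ l) (hbase : ∀ m : ℕ, (m : ℝ) ≤ m₀ → P m K)
    (hceil : ∀ m : ℕ, m₀ < m → 1 ≤ m → (⌈γ * m⌉₊ : ℝ) ≤ γ' * m)
    (hstep : ∀ m : ℕ, m₀ < m → 1 ≤ m → ⌈γ * m⌉₊ ≤ m → ∀ b : ℝ, 0 ≤ b → P ⌈γ * m⌉₊ b →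
      P m (2 * b + 2 * l))
    {m : ℕ} (hm : 1 ≤ m) : P m ((K + 2 * l) * (m : ℝ) ^ κ) := by
  -- Subtracting `2 * l` makes the bound reproduce itself under `b ↦ 2 * b + 2 * l`.
  suffices h : P m ((K + 2 * l) * (m : ℝ) ^ κ - 2 * l) from hP _ _ _ h (by linarith)
  have hge : ∀ m : ℕ, 1 ≤ m → K ≤ (K + 2 * l) * (m : ℝ) ^ κ - 2 * l := fun m hm => by
    have h1 : 1 ≤ (m : ℝ) ^ κ := Real.one_le_rpow (by exact_mod_cast hm) hκ
    nlinarith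
  induction m using Nat.strong_induction_on with
  | _ m ih =>
  rcases le_or_gt (m : ℝ) m₀ with h | h
  · exact hP _ _ _ (hbase m h) (hge m hm)
  have hm0 : (0 : ℝ) < m := by exact_mod_cast hm
  have hc := hceil m h hm
  have hlt : (⌈γ * m⌉₊ : ℝ) < m := hc.trans_lt (by nlinarith)
  have hlt' : ⌈γ * m⌉₊ < m := by exact_mod_cast hlt
  have h1 : 1 ≤ ⌈γ * m⌉₊ := Nat.ceil_pos.2 (by positivity)
  refine hP _ _ _ (hstep m h hm hlt'.le _ (hK.trans (hge _ h1)) (ih _ hlt' h1)) ?_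
  have h2 : (⌈γ * m⌉₊ : ℝ) ^ κ ≤ γ' ^ κ * (m : ℝ) ^ κ := by
    rw [← Real.mul_rpow hγ'.le hm0.le]
    exact Real.rpow_le_rpow (by positivity) hc hκ
  have h3 : 2 * (⌈γ * m⌉₊ : ℝ) ^ κ ≤ (m : ℝ) ^ κ := by
    have h4 : 2 * γ' ^ κ * (m : ℝ) ^ κ ≤ 1 * (m : ℝ) ^ κ := by gcongr
    linarith
  have h5 := mul_le_mul_of_nonneg_left h3 (show 0 ≤ K + 2 * l by positivity)
  linarith

end BlockConnection

/-! ### Boxes are contained in balls: multiscale bound on the distance. -/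

section Distance

variable {d : ℕ} {Ω : Type*} [MeasurableSpace Ω] {q : Site d → ℝ≥0∞} {μ : Measure Ω}
  {E : Ω → Set (Sym2 (Site d))}

theorem rpow_lt_two_pow {r a : ℝ} {m : ℕ} (hr : 0 < r) (h : a * Real.logb 2 r < m) :
    r ^ a < (2 : ℝ) ^ m := by
  have h2 : r ^ a = 2 ^ (a * Real.logb 2 r) := by
    rw [mul_comm, Real.rpow_mul two_pos.le, Real.rpow_logb two_pos (by norm_num) hr]
  rw [h2, ← Real.rpow_natCast]
  exact Real.rpow_lt_rpow_of_exponent_lt one_lt_two h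

theorem two_pow_le_rpow {r a : ℝ} {m : ℕ} (hr : 0 < r) (h : (m : ℝ) ≤ a * Real.logb 2 r) :
    (2 : ℝ) ^ m ≤ r ^ a := by
  have h2 : r ^ a = 2 ^ (a * Real.logb 2 r) := by
    rw [mul_comm, Real.rpow_mul two_pos.le, Real.rpow_logb two_pos (by norm_num) hr]
  rw [h2, ← Real.rpow_natCast]
  exact Real.rpow_le_rpow_of_exponent_le one_le_two h

/-- The exponent for a missing edge is at least `c / 2` times `(2 ^ m) ^ (2dγ - s)`. Half of it pays
for `l * N`; the other half brings the error down to `1 / r ≤ l`. -/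
theorem exp_error_le {c s γ l r N : ℝ} {m : ℕ} (hc : 0 ≤ c) (hr : 0 < r) (hlr : 1 / r ≤ l)
    (h1 : l * N ≤ c / 4 * ((2 : ℝ) ^ m) ^ (2 * d * γ - s))
    (h2 : Real.log r ≤ c / 4 * ((2 : ℝ) ^ m) ^ (2 * d * γ - s)) :
    Real.exp (l * N - c * ((2 : ℝ) ^ m) ^ (-s) * (((2 : ℝ) ^ (d * ⌈γ * m⌉₊)) ^ 2 / 2)) ≤ l := by
  have hX : (0 : ℝ) < 2 ^ m := by positivity
  have h3 : ((2 : ℝ) ^ m) ^ (2 * d * γ - s)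
      ≤ ((2 : ℝ) ^ m) ^ (-s) * ((2 : ℝ) ^ (d * ⌈γ * m⌉₊)) ^ 2 := by
    have h4 : ((2 : ℝ) ^ m) ^ (2 * d * γ) ≤ ((2 : ℝ) ^ (d * ⌈γ * m⌉₊)) ^ 2 := by
      rw [← pow_mul, ← Real.rpow_natCast, ← Real.rpow_natCast, ← Real.rpow_mul two_pos.le]
      refine Real.rpow_le_rpow_of_exponent_le one_le_two ?_
      push_cast
      have := Nat.le_ceil (γ * m)
      have hd : (0 : ℝ) ≤ d := by positivity
      nlinarith
    calc _ = ((2 : ℝ) ^ m) ^ (-s) * ((2 : ℝ) ^ m) ^ (2 * d * γ) := by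
          rw [← Real.rpow_add hX]; congr 1; ring
      _ ≤ _ := by gcongr
  have h5 := mul_le_mul_of_nonneg_left h3 hc
  calc _ ≤ Real.exp (-Real.log r) := Real.exp_le_exp.2 (by linarith)
    _ = 1 / r := by rw [Real.exp_neg, Real.exp_log hr, one_div]
    _ ≤ l := hlr

/-- The recursion started at side `r ^ a`, that is, at level `a * Real.logb 2 r`. It is used for two
ranges of scales with different `γ`, `κ` and `a`. -/
theorem IsLongRangePercolation.momentBound_rpow [IsProbabilityMeasure μ]
    (hE : IsLongRangePercolation q μ E) (hd : 0 < d) {c s R : ℝ} (hc : 0 ≤ c) (hs : 0 ≤ s)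
    (hq : ∀ x : Site d, R ≤ ‖x‖ → ENNReal.ofReal (c * ‖x‖ ^ (-s)) ≤ q x) {l : ℝ} (hl : 0 ≤ l)
    {T : ℕ} {o : Site d} {γ γ' κ a K r : ℝ} (hγ : 0 < γ) (hγγ' : γ < γ') (hγ'1 : γ' < 1)
    (hκ : 0 ≤ κ) (hγκ : 2 * γ' ^ κ ≤ 1) (hK : 0 ≤ K) (hr : 0 < r) (hlr : 1 / r ≤ l)
    (hN : (((2 * ⌈R⌉₊ + 1) ^ d * 2 : ℕ) : ℝ) ≤ γ * (a * Real.logb 2 r))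
    (hceil : 1 / (γ' - γ) ≤ a * Real.logb 2 r)
    (herr : ∀ X : ℝ, r ^ a < X → 1 ≤ X → l * min ((d : ℝ) * X) (T : ℝ)
      ≤ c / 4 * X ^ (2 * d * γ - s) ∧ Real.log r ≤ c / 4 * X ^ (2 * d * γ - s))
    (hbase : ∀ m : ℕ, (m : ℝ) ≤ a * Real.logb 2 r → MomentBound μ E l T o m K)
    {m : ℕ} (hm : 1 ≤ m) : MomentBound μ E l T o m ((K + 2 * l) * (m : ℝ) ^ κ) := by
  refine rpow_bound_of_recursion (P := MomentBound μ E l T o) (fun m b b' h hb => h.mono hb)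
    hγ (hγ.trans hγγ') hγ'1 hκ hγκ hK hl hbase ?_ ?_ hm
  · intro m hm₀ hm1
    have h1 := (Nat.ceil_lt_add_one (a := γ * m) (by positivity)).le
    have h2 : 1 ≤ (m : ℝ) * (γ' - γ) := (div_le_iff₀ (sub_pos.2 hγγ')).1 (hceil.trans hm₀.le)
    linarith
  · intro m hm₀ hm1 hle b hb hPb
    have hX := rpow_lt_two_pow hr hm₀
    obtain ⟨e1, e2⟩ := herr _ hX (one_le_pow₀ one_le_two)
    refine hE.momentBound_step hc hs hq hl hle ?_ (exp_error_le hc hr hlr e1 e2) hb hPb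
    have h1 : (((2 * ⌈R⌉₊ + 1) ^ d * 2 : ℕ) : ℝ) ≤ (⌈γ * m⌉₊ : ℝ) :=
      hN.trans ((mul_le_mul_of_nonneg_left hm₀.le hγ.le).trans (Nat.le_ceil _))
    have h2 : (2 * ⌈R⌉₊ + 1) ^ d * 2 ≤ ⌈γ * m⌉₊ := by exact_mod_cast h1
    exact h2.trans ((Nat.lt_two_pow_self).le.trans
      (Nat.pow_le_pow_right two_pos (Nat.le_mul_of_pos_left _ hd)))

theorem min_le_rpow_mul_rpow {u v p : ℝ} (hu : 0 ≤ u) (hv : 0 ≤ v) (hp : 0 ≤ p) (hp1 : p ≤ 1) :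
    min u v ≤ u ^ p * v ^ (1 - p) := by
  have h0 : 0 ≤ min u v := le_min hu hv
  calc min u v = min u v ^ p * min u v ^ (1 - p) := by
        rw [← Real.rpow_add_of_nonneg h0 hp (by linarith)]
        simp
    _ ≤ _ := by
        gcongr
        · exact min_le_left _ _
        · exact min_le_right _ _

/-- Ensures that `ν < 1 / Δ` can also satisfy `s + ν < 2 * d`, as the lower range of scales
requires. It follows from concavity of the logarithm: on `[1/2, 1]` its graph lies above the chord.
-/
theorem logb_two_mul_le {d : ℕ} (hd : 1 ≤ d) {s : ℝ} (hs : s ∈ Set.Ioo (d : ℝ) (2 * d)) :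
    Real.logb 2 (2 * d / s) ≤ 2 * d - s := by
  obtain ⟨hs1, hs2⟩ := hs
  have hd1 : (1 : ℝ) ≤ d := by exact_mod_cast hd
  have hs0 : 0 < s := by linarith
  have hx0 : 0 < s / (2 * d) := by positivity
  have hx1 : s / (2 * d) < 1 := (div_lt_one (by linarith)).2 hs2
  have hx2 : 1 / 2 < s / (2 * d) := by
    rw [lt_div_iff₀ (by linarith)]
    linarith
  have hconc := (strictConcaveOn_log_Ioi.concaveOn).2 (show (1 / 2 : ℝ) ∈ Set.Ioi 0 by norm_num)
    (show (1 : ℝ) ∈ Set.Ioi 0 by norm_num) (show 0 ≤ 2 - 2 * (s / (2 * d)) by linarith)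
    (show 0 ≤ 2 * (s / (2 * d)) - 1 by linarith) (by ring)
  simp only [smul_eq_mul, Real.log_one, mul_zero, add_zero, mul_one] at hconc
  have harg : (2 - 2 * (s / (2 * d))) * (1 / 2) + (2 * (s / (2 * d)) - 1) = s / (2 * d) := by ring
  rw [harg, one_div, Real.log_inv] at hconc
  have hlog2 : 0 < Real.log 2 := Real.log_pos one_lt_two
  rw [Real.logb, div_le_iff₀ hlog2]
  have hinv : Real.log (2 * d / s) = -Real.log (s / (2 * d)) := by
    rw [← Real.log_inv, inv_div]
  have hfrac : 2 - 2 * (s / (2 * d)) ≤ 2 * d - s := by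
    have h1 : 2 - 2 * (s / (2 * d)) = (2 * d - s) / d := by field_simp
    rw [h1]
    exact div_le_self (by linarith) hd1
  rw [hinv]
  nlinarith

theorem mem_dyadicBox_of_mem_box {L : ℝ} {k : ℕ} (hL : L < 2 ^ k) {x : Site d} (hx : x ∈ box d L) :
    x ∈ dyadicBox (fun _ => -2 ^ k) (k + 1) 0 := by
  have hk : (0 : ℤ) < 2 ^ k := by positivity
  rw [mem_dyadicBox]
  intro i
  have h1 : |(x i : ℝ)| < 2 ^ k := (hx i).trans_lt hL
  have h2 : |x i| < 2 ^ k := by exact_mod_cast h1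
  rw [abs_lt] at h2
  have h3 : (0 : Site d) i = 0 := rfl
  rw [h3, pow_succ, Int.ediv_eq_zero_of_lt (by linarith) (by linarith),
    Int.ediv_eq_zero_of_lt (by linarith) (by linarith)]

/-- Markov's inequality and a union bound over a dyadic box. -/
theorem IsLongRangePercolation.measure_not_box_subset_le [IsProbabilityMeasure μ]
    (hE : IsLongRangePercolation q μ E) {l r L b : ℝ} {k : ℕ} (hl : 0 ≤ l) (hr : 0 ≤ r)
    (hL : L < 2 ^ k) (h : MomentBound μ E l (⌊r⌋₊ + 1) (fun _ => -2 ^ k) (k + 1) b) :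
    μ {ω | ¬ box d L ⊆ intrinsicBall (E ω) r}
      ≤ ENNReal.ofReal (2 ^ (d * (k + 1)) * Real.exp (b - l * r)) := by
  -- The truncation level exceeds `r`, so a truncated distance below `r` is a true one.
  set T := ⌊r⌋₊ + 1
  set B := dyadicBox (d := d) (fun _ => -2 ^ k) (k + 1) 0
  have h0 : (0 : Site d) ∈ B := self_mem_dyadicBox _ _ _
  have hsub : {ω | ¬ box d L ⊆ intrinsicBall (E ω) r} ⊆ ⋃ x ∈ B,
      {ω | ENNReal.ofReal (Real.exp (l * r)) ≤ ENNReal.ofReal (Real.exp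
        (l * truncDist T (conf (edgeEvent E) ω ∩ inner B) 0 x))} := by
    intro ω hω
    obtain ⟨x, hx, hx'⟩ := Set.not_subset.1 hω
    refine Set.mem_biUnion (mem_dyadicBox_of_mem_box hL hx) ?_
    refine ENNReal.ofReal_le_ofReal (Real.exp_le_exp.2 (mul_le_mul_of_nonneg_left ?_ hl))
    by_contra hlt
    have hTr : r < T := by simpa [T] using Nat.lt_floor_add_one r
    have h1 : truncDist T (conf (edgeEvent E) ω ∩ inner B) 0 x < T := by
      have := (not_le.1 hlt).trans hTr
      exact_mod_cast this
    have h2 := monotone_conn _ _ _ Set.inter_subset_left (conn_of_truncDist_lt h1)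
    rw [conf_edgeEvent, conn_edgeSet_iff] at h2
    refine hx' ((mem_intrinsicBall hr).2 (h2.trans ?_))
    exact_mod_cast Nat.lt_succ_iff.1 h1
  have hx : ∀ x ∈ B, μ {ω | ENNReal.ofReal (Real.exp (l * r)) ≤ ENNReal.ofReal (Real.exp
        (l * truncDist T (conf (edgeEvent E) ω ∩ inner B) 0 x))}
      ≤ ENNReal.ofReal (Real.exp (b - l * r)) := by
    intro x hx
    have hm : Measurable fun ω => ENNReal.ofReal (Real.exp
        (l * truncDist T (conf (edgeEvent E) ω ∩ inner B) 0 x)) :=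
      (measurable_confSigma (edgeEvent E) (finite_inner B.finite_toSet)
        (fun S => ENNReal.ofReal (Real.exp (l * truncDist T S 0 x)))).mono
        (confSigma_le hE.measurableSet_edgeEvent _) le_rfl
    refine (meas_ge_le_lintegral_div hm.aemeasurable (by simpa using Real.exp_pos _)
      ENNReal.ofReal_ne_top).trans ?_
    rw [Real.exp_sub, ENNReal.ofReal_div_of_pos (Real.exp_pos _)]
    gcongr
    exact h 0 0 h0 x hx
  refine (measure_mono hsub).trans ((measure_biUnion_finset_le _ _).trans ?_)
  refine (Finset.sum_le_card_nsmul _ _ _ hx).trans_eq ?_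
  rw [card_dyadicBox, nsmul_eq_mul, ENNReal.ofReal_mul (by positivity)]
  congr 1
  rw [ENNReal.ofReal_pow (by norm_num)]
  simp

theorem eventually_const_mul_logb_rpow_le {C b p a : ℝ} (ha : 0 < a) (hb : 0 ≤ b) :
    ∀ᶠ r : ℝ in atTop, C * (b * Real.logb 2 r) ^ p ≤ r ^ a := by
  have h1 : Tendsto (fun r : ℝ => (Real.log r) ^ p / r ^ a) atTop (𝓝 0) :=
    (isLittleO_log_rpow_rpow_atTop p ha).tendsto_div_nhds_zero
  have h2 := (h1.const_mul (C * (b / Real.log 2) ^ p)).eventually_le_const (u := 1) (by simp)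
  filter_upwards [h2, eventually_ge_atTop 1] with r hr hr1
  have hlog : 0 ≤ Real.log r := Real.log_nonneg hr1
  have hlog2 : 0 < Real.log 2 := Real.log_pos one_lt_two
  have hra : 0 < r ^ a := Real.rpow_pos_of_pos (by linarith) _
  have h3 : b * Real.logb 2 r = b / Real.log 2 * Real.log r := by
    rw [Real.logb]; ring
  rw [h3, Real.mul_rpow (by positivity) hlog]
  rw [← mul_div_assoc, div_le_one hra] at hr
  linarith

theorem eventually_log_le_rpow {C a : ℝ} (hC : 0 < C) (ha : 0 < a) :
    ∀ᶠ r : ℝ in atTop, Real.log r ≤ C * r ^ a := by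
  have h1 := (isLittleO_log_rpow_atTop ha).bound hC
  filter_upwards [h1, eventually_ge_atTop 1] with r hr hr1
  rw [Real.norm_of_nonneg (Real.log_nonneg hr1),
    Real.norm_of_nonneg (Real.rpow_nonneg (by linarith) _)] at hr
  exact hr

theorem eventually_const_mul_rpow_le {C C' a b : ℝ} (hC : 0 < C) (hab : a < b) :
    ∀ᶠ r : ℝ in atTop, C' * r ^ a ≤ C * r ^ b := by
  have h1 := (tendsto_rpow_neg_atTop (sub_pos.2 hab)).const_mul C'
  have h2 := h1.eventually_le_const (u := C) (by simpa using hC)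
  filter_upwards [h2, eventually_gt_atTop 0] with r hr hr0
  have h3 : r ^ a = r ^ (-(b - a)) * r ^ b := by
    rw [← Real.rpow_add hr0]; congr 1; ring
  rw [h3, ← mul_assoc]
  gcongr

theorem eventually_le_const_mul_logb {C a : ℝ} (ha : 0 < a) :
    ∀ᶠ r : ℝ in atTop, C ≤ a * Real.logb 2 r :=
  ((Real.tendsto_logb_atTop one_lt_two).const_mul_atTop ha).eventually_ge_atTop C

/-- Two ranges of scales are needed. With the optimal `γ` near `2 ^ (-ν)`, the gain `δ` may be too
small to control the missing-edge error below side `r ^ b`, while the trivial bound is affordable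
only up to side `r ^ a` with `a` small. Between the two, a ratio `γ₁` closer to 1 gives a gain `δ₁ >
ν`; its poor exponent `n₁` costs only a power of `log r`, since `m` is of order `log r` there. -/
theorem IsLongRangePercolation.eventually_momentBound [IsProbabilityMeasure μ]
    (hE : IsLongRangePercolation q μ E) (hd : 1 ≤ d) {s θ A : ℝ}
    (hs : s ∈ Set.Ioo (d : ℝ) (2 * d)) (hlim : HasDecayExponent q s) (hθ0 : 0 < θ)
    (hθ : θ < 1 / Delta d s) (hA : 1 ≤ A) :
    ∀ᶠ r : ℝ in atTop, ∀ (o : Site d) (m : ℕ), 1 ≤ m → (m : ℝ) ≤ 4 * r ^ θ →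
      MomentBound μ E (A * r ^ (θ - 1)) (⌊r⌋₊ + 1) o m (r ^ θ) := by
  have hwle := logb_two_mul_le hd hs
  obtain ⟨hs1, hs2⟩ := hs
  have hd1 : (1 : ℝ) ≤ d := by exact_mod_cast hd
  have hd0 : (0 : ℝ) < d := by linarith
  have hs0 : 0 < s := by linarith
  rw [one_div_Delta] at hθ
  have hw1 : Real.logb 2 (2 * d / s) < 1 := by
    rw [Real.logb_lt_iff_lt_rpow one_lt_two (by positivity), Real.rpow_one, div_lt_iff₀ hs0]
    linarith
  obtain ⟨ν, hθν, hνw⟩ := exists_between hθ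
  have hν0 : 0 < ν := hθ0.trans hθν
  have hν1 : ν < 1 := hνw.trans hw1
  have hpow : s < 2 * d * 2 ^ (-ν) := by
    have h1 : (2 : ℝ) ^ ν < 2 * d / s := by
      rwa [Real.lt_logb_iff_rpow_lt one_lt_two (by positivity)] at hνw
    rw [lt_div_iff₀ hs0] at h1
    rw [Real.rpow_neg two_pos.le, ← div_eq_mul_inv, lt_div_iff₀ (by positivity)]
    linarith
  obtain ⟨s₂, hs₂l, hs₂u⟩ := exists_between (lt_min hpow (show s < 2 * d - ν by linarith))
  have hs₂a : s₂ < 2 * d * 2 ^ (-ν) := hs₂u.trans_le (min_le_left _ _)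
  have hs₂b : s₂ < 2 * d - ν := hs₂u.trans_le (min_le_right _ _)
  have hs₂0 : 0 < s₂ := hs0.trans hs₂l
  obtain ⟨c, R, hc, hq⟩ := hlim.exists_le (by omega) hs₂l hs0.le
  have h2d : (0 : ℝ) < 2 * d := by linarith
  obtain ⟨γ, hγl, hγu⟩ := exists_between
    (show s₂ / (2 * d) < 2 ^ (-ν) by rw [div_lt_iff₀ h2d]; linarith)
  have hγ0 : 0 < γ := (div_pos hs₂0 h2d).trans hγl
  have hδ : 0 < 2 * d * γ - s₂ := by
    rw [div_lt_iff₀ h2d] at hγl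
    linarith
  set δ := 2 * d * γ - s₂ with hδdef
  have hγ'1 : (2 : ℝ) ^ (-ν) < 1 := Real.rpow_lt_one_of_one_lt_of_neg one_lt_two (by linarith)
  obtain ⟨γ₁, hγ₁l, hγ₁u⟩ := exists_between
    (show (s₂ + ν) / (2 * d) < 1 by rw [div_lt_one h2d]; linarith)
  have hγ₁0 : 0 < γ₁ := (div_pos (by linarith) h2d).trans hγ₁l
  have hδ₁ : ν < 2 * d * γ₁ - s₂ := by
    rw [div_lt_iff₀ h2d] at hγ₁l
    linarith
  set δ₁ := 2 * d * γ₁ - s₂ with hδ₁def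
  obtain ⟨γ₁', hγ₁'l, hγ₁'u⟩ := exists_between hγ₁u
  obtain ⟨n₁, hn₁⟩ := exists_pow_lt_of_lt_one (show (0 : ℝ) < 1 / 2 by norm_num) hγ₁'u
  set κ := 1 / ν with hκdef
  have hκ0 : 0 < κ := by positivity
  have hκθ : κ * θ < 1 := by
    rw [hκdef, one_div, inv_mul_lt_iff₀ hν0]
    linarith
  -- Half of the room `1 - κ * θ`: one `r ^ a` is the trivial starting bound, a second one swallows
  -- the logarithms, and the exponents at the end add up to `θ`.
  set a := (1 - κ * θ) / 2 with hadef
  have ha : 0 < a := by linarith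
  -- Chosen so that `b * δ > θ`: beyond side `r ^ b` the gain exceeds `l * T`, which is of order `r
  -- ^ θ`.
  set b := a + (θ + 1) / δ with hbdef
  have hab : a ≤ b := le_add_of_nonneg_right (by positivity)
  have hb0 : 0 < b := ha.trans_le hab
  have hbδ : θ < b * δ := by
    rw [hbdef, add_mul, div_mul_cancel₀ _ hδ.ne']
    nlinarith
  have hδ₁0 : 0 < δ₁ := hν0.trans hδ₁
  set N₀ : ℝ := (((2 * ⌈R⌉₊ + 1) ^ d * 2 : ℕ) : ℝ)
  set C₁ : ℝ := A * d ^ ν * 2 ^ (1 - ν)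
  have hc4 : 0 < c / 4 := by linarith
  filter_upwards [eventually_ge_atTop 1,
    eventually_le_const_mul_logb (C := N₀) (mul_pos hγ₁0 ha),
    eventually_le_const_mul_logb (C := N₀) (mul_pos hγ0 hb0),
    eventually_le_const_mul_logb (C := 1 / (γ₁' - γ₁)) ha,
    eventually_le_const_mul_logb (C := 1 / (2 ^ (-ν) - γ)) hb0,
    eventually_le_const_mul_logb (C := 1) hb0,
    eventually_log_le_rpow hc4 (mul_pos ha hδ₁0),
    eventually_log_le_rpow hc4 (mul_pos hb0 hδ),
    eventually_const_mul_rpow_le (C' := 2 * A) hc4 hbδ,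
    eventually_const_mul_rpow_le (C' := C₁) hc4 (show θ - ν < 0 by linarith),
    eventually_const_mul_logb_rpow_le (C := 2 * A * (d + 2) * 4 ^ κ) (p := n₁) ha hb0.le]
    with r hr e1 e2 e3 e4 e5 e6 e7 e8 e9 e10
  intro o m hm1 hm
  have hr0 : 0 < r := by linarith
  set l := A * r ^ (θ - 1) with hldef
  have hl : 0 < l := by positivity
  have hlr : 1 / r ≤ l := by
    rw [one_div, ← Real.rpow_neg_one, hldef]
    have h1 : r ^ (-1 : ℝ) ≤ r ^ (θ - 1) :=
      Real.rpow_le_rpow_of_exponent_le hr (by linarith only [hθ0])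
    exact h1.trans (le_mul_of_one_le_left (by positivity) hA)
  have hT : ((⌊r⌋₊ + 1 : ℕ) : ℝ) ≤ 2 * r := by
    push_cast
    have := Nat.floor_le hr0.le
    linarith only [this, hr]
  have hT0 : (0 : ℝ) ≤ ((⌊r⌋₊ + 1 : ℕ) : ℝ) := by positivity
  set K₁ := l * (d * r ^ a) with hK₁def
  have hra : 1 ≤ r ^ a := Real.one_le_rpow hr ha.le
  have hlow : ∀ m : ℕ, 1 ≤ m →
      MomentBound μ E l (⌊r⌋₊ + 1) o m ((K₁ + 2 * l) * (m : ℝ) ^ (n₁ : ℝ)) := fun m hm => by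
    refine hE.momentBound_rpow (by omega) hc.le hs₂0.le hq hl.le hγ₁0 hγ₁'l hγ₁'u
      (Nat.cast_nonneg n₁) (by rw [Real.rpow_natCast]; linarith only [hn₁]) (by positivity) hr0 hlr
      (by rw [← mul_assoc]; exact e1) e3 ?_ ?_ hm
    · intro X hX hX1
      rw [← hδ₁def]
      have hX0 : 0 < X := zero_lt_one.trans_le hX1
      have hXδ : r ^ (a * δ₁) ≤ X ^ δ₁ := by
        rw [Real.rpow_mul hr0.le]
        exact Real.rpow_le_rpow (by positivity) hX.le hδ₁0.le
      refine ⟨?_, e6.trans (by gcongr)⟩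
      rw [Real.rpow_zero, mul_one] at e9
      -- Interpolating the two bounds on the distance with weight `ν` leaves `r ^ (θ - ν)`, which
      -- tends to 0, times `X ^ ν`; here `ν < δ₁`.
      calc l * min ((d : ℝ) * X) ((⌊r⌋₊ + 1 : ℕ) : ℝ)
          ≤ l * (((d : ℝ) * X) ^ ν * (2 * r) ^ (1 - ν)) := by
            gcongr
            refine (min_le_min_left _ hT).trans ?_
            exact min_le_rpow_mul_rpow (by positivity) (by positivity) hν0.le hν1.le
        _ = C₁ * r ^ (θ - ν) * X ^ ν := by
            have h1 : r ^ (θ - ν) = r ^ (θ - 1) * r ^ (1 - ν) := by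
              rw [← Real.rpow_add hr0]; congr 1; ring
            rw [h1, Real.mul_rpow hd0.le hX0.le, Real.mul_rpow two_pos.le hr0.le, hldef]
            simp only [C₁]
            ring
        _ ≤ c / 4 * X ^ δ₁ := by
            gcongr
    · intro m hm
      refine (momentBound_trivial hl.le _ o m).mono ?_
      rw [hK₁def]
      gcongr
      exact two_pow_le_rpow hr0 hm
  set K₂ := (K₁ + 2 * l) * (b * Real.logb 2 r) ^ (n₁ : ℝ) with hK₂def
  have hK₁0 : 0 ≤ K₁ := by positivity
  have hbl : 1 ≤ (b * Real.logb 2 r) ^ (n₁ : ℝ) := Real.one_le_rpow e5 (Nat.cast_nonneg _)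
  have hK₂ge : K₁ + 2 * l ≤ K₂ := le_mul_of_one_le_right (by positivity) hbl
  have hbaseb : ∀ m : ℕ, (m : ℝ) ≤ b * Real.logb 2 r →
      MomentBound μ E l (⌊r⌋₊ + 1) o m K₂ := by
    intro m hm
    rcases Nat.eq_zero_or_pos m with rfl | hm0
    · refine (momentBound_trivial hl.le _ o 0).mono (le_trans ?_ hK₂ge)
      rw [pow_zero, mul_one, hK₁def]
      have : l * d ≤ l * (d * r ^ a) := by
        gcongr
        exact le_mul_of_one_le_right hd0.le hra
      linarith only [this, hl]
    · refine (hlow m hm0).mono ?_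
      rw [hK₂def]
      gcongr
  have hhigh := hE.momentBound_rpow (by omega) hc.le hs₂0.le hq hl.le (T := ⌊r⌋₊ + 1) (o := o)
    (κ := κ) (K := K₂) hγ0 hγu hγ'1 hκ0.le
    (by
      rw [← Real.rpow_mul two_pos.le, hκdef, neg_mul, mul_one_div_cancel hν0.ne',
        Real.rpow_neg_one]
      norm_num) (hK₁0.trans ((le_add_of_nonneg_right (by positivity)).trans hK₂ge)) hr0 hlr
    (by rw [← mul_assoc]; exact e2) e4
    (by
      intro X hX hX1
      rw [← hδdef]
      have hXδ : r ^ (b * δ) ≤ X ^ δ := by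
        rw [Real.rpow_mul hr0.le]
        exact Real.rpow_le_rpow (by positivity) hX.le hδ.le
      refine ⟨?_, e7.trans (by gcongr)⟩
      calc l * min ((d : ℝ) * X) ((⌊r⌋₊ + 1 : ℕ) : ℝ) ≤ l * (2 * r) := by
            gcongr
            exact (min_le_right _ _).trans hT
        _ = 2 * A * r ^ θ := by
            have h1 : r ^ θ = r ^ (θ - 1) * r := by
              rw [← Real.rpow_add_one hr0.ne']; congr 1; ring
            rw [h1, hldef]; ring
        _ ≤ c / 4 * r ^ (b * δ) := e8
        _ ≤ c / 4 * X ^ δ := by gcongr)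
    hbaseb hm1
  refine hhigh.mono ?_
  have hlK : l * d * r ^ a + 2 * l ≤ l * (d + 2) * r ^ a := by
    have : 2 * l ≤ 2 * l * r ^ a := le_mul_of_one_le_right (by positivity) hra
    linarith only [this]
  have hsum : K₂ + 2 * l ≤ 2 * (l * (d + 2) * r ^ a * (b * Real.logb 2 r) ^ (n₁ : ℝ)) := by
    have h1 : K₂ ≤ l * (d + 2) * r ^ a * (b * Real.logb 2 r) ^ (n₁ : ℝ) := by
      rw [hK₂def, hK₁def]
      gcongr
      linarith only [hlK]
    linarith only [h1, hK₂ge, hK₁0]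
  calc (K₂ + 2 * l) * (m : ℝ) ^ κ
      ≤ (2 * (l * (d + 2) * r ^ a * (b * Real.logb 2 r) ^ (n₁ : ℝ))) * (4 * r ^ θ) ^ κ := by
        gcongr
    _ = (2 * A * (d + 2) * 4 ^ κ * (b * Real.logb 2 r) ^ (n₁ : ℝ))
          * (r ^ (θ - 1) * r ^ a * r ^ (θ * κ)) := by
        rw [Real.mul_rpow (x := 4) (by norm_num) (by positivity), ← Real.rpow_mul hr0.le, hldef]
        ring
    _ ≤ r ^ a * (r ^ (θ - 1) * r ^ a * r ^ (θ * κ)) := by gcongr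
    _ = r ^ θ := by
        rw [← Real.rpow_add hr0, ← Real.rpow_add hr0, ← Real.rpow_add hr0]
        congr 1
        rw [hadef]
        ring

/-- The box of side `exp (r ^ θ)` is contained in the intrinsic ball for `θ < 1 / Δ`. -/
theorem IsLongRangePercolation.tendsto_measure_not_box_subset [IsProbabilityMeasure μ]
    (hE : IsLongRangePercolation q μ E) {s θ : ℝ} (hs : s ∈ Set.Ioo (d : ℝ) (2 * d))
    (hlim : HasDecayExponent q s) (hθ0 : 0 < θ) (hθ : θ < 1 / Delta d s) :
    Tendsto (fun r : ℝ => μ {ω | ¬ box d (Real.exp (r ^ θ)) ⊆ intrinsicBall (E ω) r})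
      atTop (𝓝 0) := by
  have hd : 1 ≤ d := by
    have : (0 : ℝ) < d := by linarith [hs.1, hs.2]
    exact_mod_cast this
  have hlim0 : Tendsto (fun r : ℝ => ENNReal.ofReal (4 ^ d * Real.exp (-r ^ θ))) atTop (𝓝 0) := by
    have h1 := ((Real.tendsto_exp_neg_atTop_nhds_zero.comp (tendsto_rpow_atTop hθ0)).const_mul
      ((4 : ℝ) ^ d))
    rw [mul_zero] at h1
    have h2 := ENNReal.tendsto_ofReal h1
    rwa [ENNReal.ofReal_zero] at h2
  refine tendsto_of_tendsto_of_tendsto_of_le_of_le' tendsto_const_nhds hlim0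
    (Eventually.of_forall fun _ => zero_le) ?_
  filter_upwards [eventually_ge_atTop 1,
    -- Of `d + 2`, `d` pays for the number of sites in the box and 1 for the moment bound `r ^ θ`;
    -- the last 1 leaves the decay `exp (-r ^ θ)`.
    hE.eventually_momentBound hd hs hlim hθ0 hθ (A := d + 2) (by linarith [d.cast_nonneg (α := ℝ)])]
    with r hr hmom
  have hr0 : 0 < r := by linarith
  set H := r ^ θ with hHdef
  have hH : 1 ≤ H := Real.one_le_rpow hr hθ0.le
  have hlog2 : 0 < Real.log 2 := Real.log_pos one_lt_two
  have hlog2' : 1 / 2 < Real.log 2 := by linarith [Real.log_two_gt_d9]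
  set k := ⌊H / Real.log 2⌋₊ + 1 with hkdef
  have hfl : (⌊H / Real.log 2⌋₊ : ℝ) ≤ H / Real.log 2 := Nat.floor_le (by positivity)
  have hk4 : ((k + 1 : ℕ) : ℝ) ≤ 4 * H := by
    have h1 : H / Real.log 2 ≤ 2 * H := by
      rw [div_le_iff₀ hlog2]
      nlinarith
    push_cast [hkdef]
    linarith
  have hL : Real.exp H < 2 ^ k := by
    rw [← Real.rpow_natCast, Real.rpow_def_of_pos two_pos]
    refine Real.exp_lt_exp.2 ?_
    have h1 : H / Real.log 2 < k := by
      simpa [hkdef] using Nat.lt_floor_add_one (H / Real.log 2)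
    rw [div_lt_iff₀ hlog2] at h1
    linarith
  refine (hE.measure_not_box_subset_le (by positivity) hr0.le hL
    (hmom _ (k + 1) (by omega) hk4)).trans (ENNReal.ofReal_le_ofReal ?_)
  have hlr : (d + 2) * r ^ (θ - 1) * r = (d + 2) * H := by
    rw [mul_assoc, ← Real.rpow_add_one hr0.ne', hHdef]
    congr 2
    ring
  have hcard : (2 : ℝ) ^ (d * (k + 1)) ≤ 4 ^ d * Real.exp (d * H) := by
    have h1 : (4 : ℝ) ^ d = 2 ^ (d * 2) := by rw [mul_comm d, pow_mul]; norm_num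
    have h2 : d * (k + 1) = d * 2 + d * ⌊H / Real.log 2⌋₊ := by rw [hkdef]; ring
    rw [h1, h2, pow_add]
    gcongr
    rw [← Real.rpow_natCast, Real.rpow_def_of_pos two_pos]
    refine Real.exp_le_exp.2 ?_
    push_cast
    rw [le_div_iff₀ hlog2] at hfl
    have hd0 : (0 : ℝ) ≤ d := by positivity
    nlinarith
  rw [hlr]
  calc (2 : ℝ) ^ (d * (k + 1)) * Real.exp (H - (d + 2) * H)
      ≤ 4 ^ d * Real.exp (d * H) * Real.exp (H - (d + 2) * H) := by gcongr
    _ = 4 ^ d * Real.exp (-H) := by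
        rw [mul_assoc, ← Real.exp_add]
        congr 2
        ring

end Distance

/-! ### Cardinality of boxes and doubly logarithmic size. -/

section BoxCard

variable {d : ℕ}

theorem box_eq (L : ℝ) :
    box d L = (Fintype.piFinset fun _ : Fin d => Finset.Icc (-⌊L⌋) ⌊L⌋ : Finset (Site d)) := by
  ext x
  rw [Finset.mem_coe, Fintype.mem_piFinset]
  refine forall_congr' fun i => ?_
  rw [Finset.mem_Icc, abs_le, neg_le, neg_le (a := ⌊L⌋), Int.le_floor, Int.le_floor]
  push_cast
  rfl

theorem finite_box (L : ℝ) : (box d L).Finite := by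
  rw [box_eq]
  exact Finset.finite_toSet _

theorem box_mono {L L' : ℝ} (h : L ≤ L') : box d L ⊆ box d L' :=
  fun _ hx i => (hx i).trans h

theorem ncard_box {L : ℝ} (hL : 0 ≤ L) : ((box d L).ncard : ℝ) = (2 * ⌊L⌋ + 1) ^ d := by
  have hfl : 0 ≤ ⌊L⌋ := Int.floor_nonneg.2 hL
  have h1 : (((2 * ⌊L⌋ + 1).toNat : ℕ) : ℝ) = 2 * ⌊L⌋ + 1 := by
    have h2 : (((2 * ⌊L⌋ + 1).toNat : ℕ) : ℤ) = 2 * ⌊L⌋ + 1 := Int.toNat_of_nonneg (by omega)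
    exact_mod_cast h2
  rw [box_eq, Set.ncard_coe_finset, Fintype.card_piFinset]
  simp only [Int.card_Icc, Finset.prod_const, Finset.card_univ, Fintype.card_fin]
  rw [← h1]
  push_cast
  congr 3
  omega

theorem le_ncard_box (hd : 1 ≤ d) {L : ℝ} (hL : 0 ≤ L) : L ≤ (box d L).ncard := by
  have hfl : (0 : ℝ) ≤ ⌊L⌋ := by exact_mod_cast Int.floor_nonneg.2 hL
  rw [ncard_box hL]
  calc L ≤ 2 * ⌊L⌋ + 1 := by linarith [Int.lt_floor_add_one L]
    _ ≤ _ := le_self_pow₀ (by linarith) (by omega)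

theorem ncard_box_le {L : ℝ} (hL : 1 ≤ L) : ((box d L).ncard : ℝ) ≤ (3 * L) ^ d := by
  have hfl : (0 : ℝ) ≤ ⌊L⌋ := by exact_mod_cast Int.floor_nonneg.2 (by linarith)
  rw [ncard_box (by linarith)]
  gcongr
  linarith [Int.floor_le L]

/-- A set between two stretched-exponential boxes has the corresponding doubly logarithmic size. -/
theorem abs_log_log_ncard_sub_lt (hd : 1 ≤ d) {S : Set (Site d)} {r w ε η : ℝ} (hr : 1 < r)
    (hw : 0 ≤ w + ε) (hε : 2 * ε ≤ η) (hlog : 2 * Real.log (3 * d) < η * Real.log r)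
    (h₁ : box d (Real.exp (r ^ (w - ε))) ⊆ S) (h₂ : S ⊆ box d (Real.exp (r ^ (w + ε)))) :
    |Real.log (Real.log (S.ncard : ℝ)) / Real.log r - w| < η := by
  have hr0 : 0 < r := by linarith
  have hd1 : (1 : ℝ) ≤ d := by exact_mod_cast hd
  have hlr : 0 < Real.log r := Real.log_pos hr
  have hp : 0 < r ^ (w - ε) := Real.rpow_pos_of_pos hr0 _
  have hp' : 1 ≤ r ^ (w + ε) := Real.one_le_rpow hr.le hw
  have hlow : Real.exp (r ^ (w - ε)) ≤ (S.ncard : ℝ) := by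
    refine (le_ncard_box hd (Real.exp_pos _).le).trans ?_
    exact_mod_cast Set.ncard_le_ncard h₁ ((finite_box _).subset h₂)
  have hN : (0 : ℝ) < S.ncard := (Real.exp_pos _).trans_le hlow
  have hup : (S.ncard : ℝ) ≤ (3 * Real.exp (r ^ (w + ε))) ^ d := by
    refine le_trans ?_ (ncard_box_le (Real.one_le_exp (by linarith)))
    exact_mod_cast Set.ncard_le_ncard h₂ (finite_box _)
  have hlow' : r ^ (w - ε) ≤ Real.log (S.ncard : ℝ) := (Real.le_log_iff_exp_le hN).2 hlow
  have hup' : Real.log (S.ncard : ℝ) ≤ 3 * d * r ^ (w + ε) := by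
    have h3 : Real.log 3 ≤ 2 := (Real.log_le_sub_one_of_pos (by norm_num)).trans (by norm_num)
    refine (Real.log_le_log hN hup).trans ?_
    rw [Real.log_pow, Real.log_mul (by norm_num) (Real.exp_pos _).ne', Real.log_exp]
    have : (d : ℝ) * (Real.log 3 + r ^ (w + ε)) ≤ d * (3 * r ^ (w + ε)) := by
      gcongr
      linarith
    linarith
  have hll : (w - ε) * Real.log r ≤ Real.log (Real.log (S.ncard : ℝ)) := by
    rw [← Real.log_rpow hr0]
    exact Real.log_le_log hp hlow'
  have hlu : Real.log (Real.log (S.ncard : ℝ)) ≤ Real.log (3 * d) + (w + ε) * Real.log r := by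
    rw [← Real.log_rpow hr0, ← Real.log_mul (by positivity) (by positivity)]
    exact Real.log_le_log (hp.trans_le hlow') hup'
  have hεr : 2 * ε * Real.log r ≤ η * Real.log r := by gcongr
  have hηr : 0 < η * Real.log r :=
    (mul_nonneg two_pos.le (Real.log_nonneg (by linarith))).trans_lt hlog
  rw [abs_lt]
  constructor
  · rw [lt_sub_iff_add_lt, lt_div_iff₀ hlr]
    linarith
  · rw [sub_lt_iff_lt_add, div_lt_iff₀ hlr]
    linarith

theorem intrinsicBall_mono (E : Set (Sym2 (Site d))) {r r' : ℝ} (h : r ≤ r') :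
    intrinsicBall E r ⊆ intrinsicBall E r' :=
  fun _ hx => le_trans hx (EReal.coe_le_coe_iff.2 h)

end BoxCard

end LongRange

end

/-! ### The growth theorem. -/

theorem theorem1p2 {d : ℕ} (q : LongRange.Site d → ℝ≥0∞) (hq : ∀ x, q (-x) = q x)
    (s : ℝ) (hs : s ∈ Set.Ioo (d : ℝ) (2 * d)) (hlim : LongRange.HasDecayExponent q s)
    {Ω : Type*} [MeasurableSpace Ω] (μ : Measure Ω) [IsProbabilityMeasure μ]
    (E : Ω → Set (Sym2 (LongRange.Site d))) (hE : LongRange.IsLongRangePercolation q μ E) :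
    (∀ ε : ℝ, 0 < ε →
      Tendsto (fun r : ℝ => μ {ω |
          LongRange.box d (Real.exp (r ^ (1 / LongRange.Delta d s - ε)))
              ⊆ LongRange.intrinsicBall (E ω) r ∧
          LongRange.intrinsicBall (E ω) r
              ⊆ LongRange.box d (Real.exp (r ^ (1 / LongRange.Delta d s + ε)))})
        atTop (𝓝 1)) ∧
    (∀ᵐ ω ∂μ, ∀ r : ℝ, (LongRange.intrinsicBall (E ω) r).Finite) ∧
    TendstoInMeasure μ
      (fun (r : ℝ) (ω : Ω) =>
        Real.log (Real.log ((LongRange.intrinsicBall (E ω) r).ncard : ℝ)) / Real.log r)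
      atTop (fun _ => 1 / LongRange.Delta d s) := by
  have hd0 : (0 : ℝ) < d := by linarith [hs.1, hs.2]
  have hd : 1 ≤ d := by exact_mod_cast hd0
  have hw : 0 < 1 / LongRange.Delta d s := by
    rw [LongRange.one_div_Delta]
    exact Real.logb_pos one_lt_two ((one_lt_div (hd0.trans hs.1)).2 hs.2)
  set w := 1 / LongRange.Delta d s
  have hbad : ∀ ε : ℝ, 0 < ε → Tendsto (fun r : ℝ => μ {ω |
      ¬ (LongRange.box d (Real.exp (r ^ (w - ε))) ⊆ LongRange.intrinsicBall (E ω) r ∧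
        LongRange.intrinsicBall (E ω) r ⊆ LongRange.box d (Real.exp (r ^ (w + ε))))})
      atTop (𝓝 0) := by
    intro ε hε
    -- For large `ε` the exponent `w - ε` need not be positive; enlarging it to at least `w / 2`
    -- only enlarges the box.
    have h1 := hE.tendsto_measure_not_box_subset hs hlim (θ := max (w - ε) (w / 2))
      (lt_max_of_lt_right (by linarith)) (max_lt (by linarith) (by linarith))
    have h2 := hE.tendsto_measure_not_subset_box hs hlim (θ := w + ε) (by linarith)
    have h12 := h1.add h2
    rw [add_zero] at h12
    refine tendsto_of_tendsto_of_tendsto_of_le_of_le' tendsto_const_nhds h12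
      (Eventually.of_forall fun _ => zero_le) ?_
    filter_upwards [eventually_ge_atTop 1] with r hr
    refine (measure_mono fun ω hω => ?_).trans (measure_union_le _ _)
    rcases not_and_or.1 hω with h | h
    · refine Or.inl fun h' => h ((LongRange.box_mono ?_).trans h')
      exact Real.exp_le_exp.2 (Real.rpow_le_rpow_of_exponent_le hr (le_max_left _ _))
    · exact Or.inr h
  refine ⟨fun ε hε => ?_, ?_, ?_⟩
  · have h1 := ENNReal.Tendsto.sub (tendsto_const_nhds (x := (1 : ℝ≥0∞)) (f := atTop))
      (hbad ε hε) (Or.inl ENNReal.one_ne_top)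
    rw [tsub_zero] at h1
    refine tendsto_of_tendsto_of_tendsto_of_le_of_le h1 tendsto_const_nhds (fun r => ?_)
      fun r => prob_le_one
    rw [tsub_le_iff_right, ← measure_univ (μ := μ)]
    refine (measure_mono fun ω _ => ?_).trans (measure_union_le _ _)
    exact em _
  · have hn : ∀ n : ℕ, ∀ᵐ ω ∂μ, (LongRange.intrinsicBall (E ω) n).Finite := by
      intro n
      -- If the ball of radius `n` is infinite, the bad event occurs for every `r ≥ n`, and its
      -- probability tends to 0.
      refine le_antisymm (ge_of_tendsto (hbad 1 one_pos) ?_) zero_le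
      filter_upwards [eventually_ge_atTop (n : ℝ)] with r hr
      refine measure_mono fun ω hω h => hω ?_
      exact (LongRange.finite_box _).subset ((LongRange.intrinsicBall_mono _ hr).trans h.2)
    filter_upwards [ae_all_iff.2 hn] with ω hω r
    obtain ⟨n, hn⟩ := exists_nat_ge r
    exact (hω n).subset (LongRange.intrinsicBall_mono _ hn)
  · rw [tendstoInMeasure_iff_dist]
    intro η hη
    refine tendsto_of_tendsto_of_tendsto_of_le_of_le' tendsto_const_nhds
      (hbad (η / 2) (by linarith)) (Eventually.of_forall fun _ => zero_le) ?_
    have hlog : Tendsto (fun r : ℝ => η * Real.log r) atTop atTop :=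
      Real.tendsto_log_atTop.const_mul_atTop hη
    filter_upwards [eventually_gt_atTop 1,
      hlog.eventually_gt_atTop (2 * Real.log (3 * d))] with r hr hr'
    refine measure_mono fun ω hω h => ?_
    refine absurd (show η ≤ dist _ _ from hω) (not_le.2 ?_)
    rw [Real.dist_eq]
    exact LongRange.abs_log_log_ncard_sub_lt hd hr (by linarith) (by linarith) hr' h.1 h.2
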